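/- Let $\mathcal K=\{K_v\}_{v\in V}$ be a finite family of non-empty compact convex sets in the plane, $\mathbb K=\bigcup_v K_v$ their union, and $s,t\in\mathbb R^2\setminus\mathbb K$. We say that $\mathbb K$ separates $s$ and $t$ if they lie in different path-connected components of $\mathbb R^2\setminus\mathbb K$. Let $G$ be the intersection graph of $\mathcal K$: its node set is $V$, and distinct $u,v$ are adjacent iff $K_u\cap K_v\neq\emptyset$. Fix a drawing of $G$: a point $p_v\in K_v$ for each node $v$, and for each edge $uv$ a polygonal curve $\gamma(uv)$ from $p_u$ to $p_v$ contained in $K_u\cup K_v$ (with $\gamma(vu)$ its reverse). A closed walk in $G$ is drawn as the closed polygonal curve obtained by concatenating the curves of its edges. Let $T$ be a maximal spanning forest of $G$, that is, an acyclic subgraph containing a spanning tree of each connected component of $G$. For an edge $e\in E(G)\setminus E(T)$ let $\tau(T,e)$ be the drawing of the unique cycle of $T+e$. Call the drawing generic with respect to points $a,b$ if no curve $\gamma(uv)$ contains $a$ or $b$ and no vertex of a curve $\gamma(uv)$ (its endpoints included) lies on the segment $ab$. In that case, for a closed walk with drawing $\pi$, let $\mathrm{CR}(ab,\pi)\in\mathbb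 Z/2$ be the parity of the number of intersections of the segment $ab$ with $\pi$, where a point traversed several times by $\pi$ is counted each time. (i) If the drawing is generic with respect to $s,t$, then, with $\ell$ the segment $st$, the set $\mathbb K$ separates $s$ and $t$ if and only if there is an edge $e\in E(G)\setminus E(T)$ with $\mathrm{CR}(\ell,\tau(T,e))=1$. (ii) In general, let $n\neq 0$ be a vector orthogonal to $t-s$. Then for all sufficiently small $\varepsilon>0$, setting $s'=s+\varepsilon n$ and letting $\ell$ be the segment $s't$, the drawing is generic with respect to $s',t$, and $\mathbb K$ separates $s$ and $t$ if and only if there is an edge $e\in E(G)\setminus E(T)$ with $\mathrm{CR}(\ell,\tau(T,e))=1$. -/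

import Mathlib

open Filter Topology

namespace ConvexSeparation

/-- The Euclidean plane. -/
abbrev Plane : Type := EuclideanSpace ℝ (Fin 2)

/-- The set `A` separates `s` and `t` (two points outside `A`): they lie in different
path-connected components of the complement of `A`. -/
def Separates (A : Set Plane) (s t : Plane) : Prop :=
  ¬ JoinedIn Aᶜ s t

/-! A polygonal curve is given by the list of its successive vertices. -/

/-- The successive edges of the polygonal curve with vertex list `π`, as pairs of endpoints. -/
def polyEdges (π : List Plane) : List (Plane × Plane) :=
  π.zip π.tail

/-- The polygonal curve `π` is generic with respect to `s` and `t`: it contains neither `s` nor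
`t`, and none of its vertices lies on the segment from `s` to `t`. -/
def IsGeneric (s t : Plane) (π : List Plane) : Prop :=
  (∀ x ∈ π, x ∉ segment ℝ s t) ∧
    ∀ e ∈ polyEdges π, s ∉ segment ℝ e.1 e.2 ∧ t ∉ segment ℝ e.1 e.2

/-- The number of intersections of the segment from `s` to `t` with the (generic) polygonal
curve `π`, a point that the curve traverses several times being counted each time. -/
noncomputable def crossingNumber (s t : Plane) (π : List Plane) : ℕ :=
  ((polyEdges π).map fun e => (segment ℝ e.1 e.2 ∩ segment ℝ s t).ncard).sum

/-- The crossing number modulo `2`. -/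
noncomputable def CR (s t : Plane) (π : List Plane) : ZMod 2 :=
  (crossingNumber s t π : ZMod 2)

/-- The intersection graph of a family of sets. -/
def intersectionGraph {V : Type*} (K : V → Set Plane) : SimpleGraph V where
  Adj u v := u ≠ v ∧ (K u ∩ K v).Nonempty
  symm := ⟨fun u v h => ⟨h.1.symm, by rw [Set.inter_comm]; exact h.2⟩⟩
  loopless := ⟨fun _ h => h.1 rfl⟩

/-- A drawing of the intersection graph of `K`: a point `p_v ∈ K_v` for each node `v`, and for
each edge `uv` a polygonal curve from `p_u` to `p_v` inside `K_u ∪ K_v`; read from `v` to `u`,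
the curve of an edge is reversed. (The values of `curve` at non-adjacent pairs are irrelevant.) -/
structure Drawing {V : Type*} (K : V → Set Plane) where
  point : V → Plane
  point_mem : ∀ v, point v ∈ K v
  curve : V → V → List Plane
  curve_head : ∀ {u v}, (intersectionGraph K).Adj u v → (curve u v).head? = some (point u)
  curve_last : ∀ {u v}, (intersectionGraph K).Adj u v → (curve u v).getLast? = some (point v)
  curve_reverse : ∀ {u v}, (intersectionGraph K).Adj u v → curve v u = (curve u v).reverse
  curve_subset : ∀ {u v}, (intersectionGraph K).Adj u v →
    ∀ e ∈ polyEdges (curve u v), segment ℝ e.1 e.2 ⊆ K u ∪ K v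

/-- The polygonal curve of a walk: the concatenation of the curves of its successive edges. -/
def Drawing.walkCurve {V : Type*} {K : V → Set Plane} (D : Drawing K) :
    {u v : V} → (intersectionGraph K).Walk u v → List Plane
  | u, _, .nil => [D.point u]
  | u, _, .cons (v := v) _ W => D.curve u v ++ (D.walkCurve W).tail

/-- All edge curves of the drawing are generic with respect to `s` and `t`. -/
def Drawing.Generic {V : Type*} {K : V → Set Plane} (D : Drawing K) (s t : Plane) : Prop :=
  ∀ u v, (intersectionGraph K).Adj u v → IsGeneric s t (D.curve u v)

/-- `T` is a maximal spanning forest of `G`: an acyclic subgraph on the same nodes that contains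
a spanning tree of each connected component of `G`. -/
structure IsMaxSpanningForest {V : Type*} (G T : SimpleGraph V) : Prop where
  le : T ≤ G
  acyclic : T.IsAcyclic
  reachable : ∀ {u v}, G.Reachable u v → T.Reachable u v

theorem IsMaxSpanningForest.exists_path {V : Type*} {G T : SimpleGraph V}
    (hT : IsMaxSpanningForest G T) {u v : V} (h : G.Adj u v) :
    ∃ P : T.Walk v u, P.IsPath :=
  (hT.reachable h.symm.reachable).exists_isPath

/-- The fundamental cycle of the edge `uv` of `G` with respect to `T`, as a closed walk based at
`u`: the edge `uv`, followed by the path in `T` from `v` back to `u`. -/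
noncomputable def fundamentalCycle {V : Type*} {G T : SimpleGraph V}
    (hT : IsMaxSpanningForest G T) {u v : V} (h : G.Adj u v) : G.Walk u u :=
  .cons h ((hT.exists_path h).choose.mapLe hT.le)

/-- If `uv` is not an edge of `T`, then the fundamental cycle is indeed a cycle. -/
theorem fundamentalCycle_isCycle {V : Type*} {G T : SimpleGraph V}
    (hT : IsMaxSpanningForest G T) {u v : V} (h : G.Adj u v) (hn : ¬ T.Adj u v) :
    (fundamentalCycle hT h).IsCycle := by
  unfold fundamentalCycle
  rw [SimpleGraph.Walk.cons_isCycle_iff]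
  refine ⟨(hT.exists_path h).choose_spec.mapLe hT.le, fun hm => hn ?_⟩
  rw [SimpleGraph.Walk.edges_mapLe_eq_edges] at hm
  exact SimpleGraph.Walk.adj_of_mem_edges _ hm

/-- All edges of the fundamental cycle of `uv` lie in `T + uv`. -/
theorem edges_fundamentalCycle {V : Type*} {G T : SimpleGraph V}
    (hT : IsMaxSpanningForest G T) {u v : V} (h : G.Adj u v) :
    ∀ e ∈ (fundamentalCycle hT h).edges, e = s(u, v) ∨ e ∈ T.edgeSet := by
  intro e he
  unfold fundamentalCycle at he
  rw [SimpleGraph.Walk.edges_cons, List.mem_cons, SimpleGraph.Walk.edges_mapLe_eq_edges] at he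
  exact he.imp id fun h' => SimpleGraph.Walk.edges_subset_edgeSet _ h'

/-- Some edge `uv` of the intersection graph outside the forest `T` has a fundamental cycle whose
drawing crosses the segment from `s` to `t` an odd number of times. -/
def HasOddFundamentalCycle {V : Type*} {K : V → Set Plane} {T : SimpleGraph V}
    (hT : IsMaxSpanningForest (intersectionGraph K) T) (D : Drawing K) (s t : Plane) : Prop :=
  ∃ (u v : V) (h : (intersectionGraph K).Adj u v),
    ¬ T.Adj u v ∧ CR s t (D.walkCurve (fundamentalCycle hT h)) = 1

end ConvexSeparation

/-!
Identify the plane with `ℂ`. The function `x ↦ viewAngle x t s` is a branch of the difference of the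
polar angles around `s` and `t` whose only cut is the segment `[s, t]`. Comparing it along `[a, b]`
with the angles swept around `s` and around `t` gives an integer, whose parity `crossParity s t a b`
is defined even when `[a, b]` is not in general position. For generic segments it is the number of
intersections (`crossParity_eq_ncard`). On a compact convex set that avoids `s` and `t` it is a
coboundary `f a + f b` (`exists_crossParity_eq_add`), since both polar angles are single-valued
there.

If `s` and `t` are joined outside the union, every closed polygonal curve in the union is crossed
evenly: up to sign, the signed number of crossings is the difference of the winding
numbers around `s` and `t`, and the winding number is constant along the path from `s` to `t`
(`sum_planeParity_eq_zero_of_joinedIn`).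

Conversely, suppose that all fundamental cycles are crossed evenly. Then the crossing parity of the
curves of the edges is the coboundary of a function on the nodes
(`exists_potential_of_not_hasOddFundamentalCycle`). As `K u ∪ K v` is star-shaped around each common
point of `K u` and `K v`, the crossing parity of the curve of `uv` can be computed on segments
through such a point (`Drawing.Generic.CR_curve`), and the function extends to a neighbourhood of
the union in such a way that its coboundary is the crossing parity of short segments. By
`joinedIn_compl_of_crossParity_eq_add`, a double counting on a fine square grid, the union then does
not separate `s` and `t`.

When the drawing is not generic, moving `s` slightly along a normal of `t - s` makes it generic:
each vertex has to be avoided by a pencil of segments ending in `t`, and it lies on none of those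
with small offset (`eventually_notMem_segment_add_smul`). The component of `s` does not change.
-/

namespace ConvexSeparation

/-! ### Angles and crossing parities in the complex plane -/

/-- The oriented angle in `(-π, π]` under which the segment from `a` to `b` is seen from `p`. -/
noncomputable def viewAngle (p a b : ℂ) : ℝ :=
  Complex.arg ((b - p) / (a - p))

/-- The angle swept around `s` minus the angle swept around `t` when moving from `a` to `b`,
corrected by the change of `x ↦ viewAngle x t s`. As the latter is a branch of the difference of
the two polar angles which is cut along the segment from `s` to `t`, this is `2π` times the signed
number of crossings of `[a, b]` with `[s, t]` when the two segments are in general position. -/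
noncomputable def angleDefect (s t a b : ℂ) : ℝ :=
  viewAngle s a b - viewAngle t a b - viewAngle b t s + viewAngle a t s

/-- The crossing parity of `[a, b]` with `[s, t]`, defined for all `a`, `b` different from `s`
and `t`, in general position or not: the quotient is then an integer, and rounding merely turns it
into an element of `ℤ`. -/
noncomputable def crossParity (s t a b : ℂ) : ZMod 2 :=
  ((round (angleDefect s t a b / (2 * Real.pi)) : ℤ) : ZMod 2)

/-- The principal argument defining `viewAngle p a b` jumps only when `p` lies on `[a, b]`. -/
theorem div_mem_slitPlane {p a b : ℂ} (h : p ∉ segment ℝ a b) :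
    (b - p) / (a - p) ∈ Complex.slitPlane := by
  rw [Complex.mem_slitPlane_iff]
  by_contra! hc
  obtain ⟨h1, h2⟩ := hc
  apply h
  have hap : a - p ≠ 0 := fun h0 => h (by
    rw [sub_eq_zero] at h0; rw [← h0]; exact left_mem_segment ℝ a b)
  set r : ℝ := ((b - p) / (a - p)).re with hr
  have hq : (b - p) / (a - p) = (r : ℂ) := Complex.ext (by simp [hr]) (by simpa using h2)
  have hb : b - p = r * (a - p) := (div_eq_iff hap).1 hq
  have h1r : (1 - r) ≠ 0 := by linarith
  have h1c : (1 - r : ℂ) ≠ 0 := by exact_mod_cast h1r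
  refine ⟨(-r) / (1 - r), 1 / (1 - r), div_nonneg (by linarith) (by linarith),
    div_nonneg zero_le_one (by linarith), by field_simp; ring, ?_⟩
  have hb' : b = p + r * (a - p) := by rw [← hb]; ring
  rw [hb']
  simp only [Complex.real_smul]
  push_cast
  field_simp
  ring

theorem viewAngle_coe {p a b : ℂ} (ha : a ≠ p) (hb : b ≠ p) :
    (viewAngle p a b : Real.Angle) = Complex.arg (b - p) - Complex.arg (a - p) :=
  Complex.arg_div_coe_angle (sub_ne_zero.2 hb) (sub_ne_zero.2 ha)

/-- Modulo `2π`, every `viewAngle` in `angleDefect` is a difference of polar angles, and these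
cancel. -/
theorem angleDefect_coe {s t a b : ℂ} (has : a ≠ s) (hat : a ≠ t) (hbs : b ≠ s) (hbt : b ≠ t) :
    (angleDefect s t a b : Real.Angle) = 0 := by
  have h : ∀ {x : ℂ}, x ≠ s → x ≠ t →
      (viewAngle x t s : Real.Angle) = Complex.arg (x - s) - Complex.arg (x - t) := by
    intro x h1 h2
    rw [← Complex.arg_div_coe_angle (sub_ne_zero.2 h1) (sub_ne_zero.2 h2), viewAngle,
      ← neg_sub x s, ← neg_sub x t, neg_div_neg_eq]
  unfold angleDefect
  rw [Real.Angle.coe_add, Real.Angle.coe_sub, Real.Angle.coe_sub, viewAngle_coe has hbs,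
    viewAngle_coe hat hbt, h has hat, h hbs hbt]
  abel

theorem exists_int_of_coe_angle_eq_zero {x : ℝ} (h : (x : Real.Angle) = 0) :
    ∃ k : ℤ, x = 2 * Real.pi * k := by
  rw [← Real.Angle.coe_zero, Real.Angle.angle_eq_iff_two_pi_dvd_sub] at h
  simpa using h

theorem crossParity_of_eq {s t a b : ℂ} {k : ℤ} (h : angleDefect s t a b = 2 * Real.pi * k) :
    crossParity s t a b = k := by
  unfold crossParity
  rw [h, mul_div_cancel_left₀ _ (by positivity), round_intCast]

/-- A continuous function on a connected set whose values are multiples of `2π` is constant. -/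
theorem eq_of_continuousOn_of_coe_angle_eq_zero {X : Type*} [TopologicalSpace X] {S : Set X}
    (hS : IsPreconnected S) {f : X → ℝ} (hf : ContinuousOn f S)
    (h : ∀ x ∈ S, (f x : Real.Angle) = 0) {x y : X} (hx : x ∈ S) (hy : y ∈ S) : f x = f y := by
  have hpc : IsPreconnected (f '' S) := hS.image f hf
  have key : ∀ u ∈ S, ∀ v ∈ S, ¬ f u < f v := by
    intro u hu v hv huv
    obtain ⟨k, hk⟩ := exists_int_of_coe_angle_eq_zero (h u hu)
    obtain ⟨l, hl⟩ := exists_int_of_coe_angle_eq_zero (h v hv)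
    have hpi := Real.pi_pos
    have hkl : k < l := by
      rw [hk, hl] at huv
      exact_mod_cast lt_of_mul_lt_mul_left huv (by positivity)
    have hkl' : (k : ℝ) + 1 ≤ l := by exact_mod_cast hkl
    -- a value strictly between two multiples of `2π` would have to be attained
    obtain ⟨w, hw, hw'⟩ := hpc.Icc_subset (Set.mem_image_of_mem f hu) (Set.mem_image_of_mem f hv)
      (show 2 * Real.pi * k + Real.pi ∈ Set.Icc (f u) (f v) from
        ⟨by linarith, by rw [hl]; nlinarith⟩)
    obtain ⟨m, hm⟩ := exists_int_of_coe_angle_eq_zero (h w hw)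
    have h2 : Real.pi * (2 * k + 1) = Real.pi * (2 * m) := by linarith
    have h3 : (2 * k + 1 : ℝ) = 2 * m := mul_left_cancel₀ hpi.ne' h2
    have h4 : 2 * k + 1 = 2 * m := by exact_mod_cast h3
    omega
  exact le_antisymm (not_lt.1 (key y hy x hx)) (not_lt.1 (key x hx y hy))

theorem continuousOn_viewAngle_right {p a : ℂ} {S : Set ℂ} (h : ∀ x ∈ S, p ∉ segment ℝ a x) :
    ContinuousOn (fun x => viewAngle p a x) S := by
  intro x hx
  exact ((Complex.continuousAt_arg (div_mem_slitPlane (h x hx))).comp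
    (f := fun x => (x - p) / (a - p)) (by fun_prop)).continuousWithinAt

theorem continuousOn_viewAngle_left {a b : ℂ} {S : Set ℂ} (h : ∀ p ∈ S, p ∉ segment ℝ a b) :
    ContinuousOn (fun p => viewAngle p a b) S := by
  intro p hp
  have hap : a - p ≠ 0 := fun h0 => h p hp (by
    rw [sub_eq_zero] at h0; rw [← h0]; exact left_mem_segment ℝ a b)
  exact ((Complex.continuousAt_arg (div_mem_slitPlane (h p hp))).comp
    (f := fun p => (b - p) / (a - p)) (by fun_prop (disch := exact hap))).continuousWithinAt

/-- Along `[a, b]`, the difference of the angles swept around `s` and `t` is the increment of any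
continuous function that agrees modulo `2π` and up to a constant with `x ↦ viewAngle x t s`. -/
theorem viewAngle_sub_viewAngle_eq {s t a b : ℂ} (hs : s ∉ segment ℝ a b)
    (ht : t ∉ segment ℝ a b) {μ : ℂ → ℝ} (hμ : ContinuousOn μ (segment ℝ a b)) {c : Real.Angle}
    (hc : ∀ x ∈ segment ℝ a b, (μ x : Real.Angle) = viewAngle x t s + c) :
    viewAngle s a b - viewAngle t a b = μ b - μ a := by
  have hsub : ∀ x ∈ segment ℝ a b, segment ℝ a x ⊆ segment ℝ a b := fun x hx =>
    (convex_segment a b).segment_subset (left_mem_segment ℝ a b) hx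
  have hne : ∀ {p : ℂ}, p ∉ segment ℝ a b → ∀ x ∈ segment ℝ a b, x ≠ p := by
    rintro p hp x hx rfl; exact hp hx
  have ha := left_mem_segment ℝ a b
  have h := eq_of_continuousOn_of_coe_angle_eq_zero (convex_segment a b).isPreconnected
    (f := fun x => viewAngle s a x - viewAngle t a x - μ x + μ a)
    ((((continuousOn_viewAngle_right fun x hx h => hs (hsub x hx h)).sub
      (continuousOn_viewAngle_right fun x hx h => ht (hsub x hx h))).sub hμ).add
        continuousOn_const) ?_ (right_mem_segment ℝ a b) ha
  · have e1 : viewAngle s a a = 0 := by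
      simp [viewAngle, div_self (sub_ne_zero.2 (hne hs a ha))]
    have e2 : viewAngle t a a = 0 := by
      simp [viewAngle, div_self (sub_ne_zero.2 (hne ht a ha))]
    simp only [e1, e2] at h
    linarith
  · intro x hx
    have := angleDefect_coe (hne hs a ha) (hne ht a ha) (hne hs x hx) (hne ht x hx)
    unfold angleDefect at this
    rw [Real.Angle.coe_add, Real.Angle.coe_sub, Real.Angle.coe_sub] at this ⊢
    rw [hc x hx, hc a ha, ← this]
    abel

theorem crossParity_eq_zero_of_disjoint {s t a b : ℂ}
    (h : Disjoint (segment ℝ a b) (segment ℝ s t)) : crossParity s t a b = 0 := by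
  have hs : s ∉ segment ℝ a b := Set.disjoint_right.1 h (left_mem_segment ℝ s t)
  have ht : t ∉ segment ℝ a b := Set.disjoint_right.1 h (right_mem_segment ℝ s t)
  have := viewAngle_sub_viewAngle_eq hs ht (μ := fun x => viewAngle x t s) (c := 0)
    (continuousOn_viewAngle_left fun x hx => by
      rw [segment_symm]; exact Set.disjoint_left.1 h hx) (by simp)
  rw [crossParity_of_eq (k := 0) (by unfold angleDefect; simp; linarith)]
  simp

/-- Twice the signed area of the triangle with vertices `s`, `t`, `x`, up to sign: it tells on
which side of the line through `s` and `t` the point `x` lies. -/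
noncomputable def lineSide (s t x : ℂ) : ℝ :=
  (x - s).im * (t - s).re - (x - s).re * (t - s).im

theorem lineSide_combo (s t : ℂ) {x y : ℂ} {p q : ℝ} (h : p + q = 1) :
    lineSide s t (p • x + q • y) = p * lineSide s t x + q * lineSide s t y := by
  obtain rfl : p = 1 - q := by linarith
  simp [lineSide]
  ring

theorem lineSide_eq_zero_of_mem_segment {s t x : ℂ} (h : x ∈ segment ℝ s t) :
    lineSide s t x = 0 := by
  obtain ⟨p, q, -, -, hpq, rfl⟩ := h
  rw [lineSide_combo s t hpq]
  simp [lineSide]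
  right; ring

theorem div_im_mul_normSq (s t x : ℂ) (h : t ≠ x) :
    ((s - x) / (t - x)).im * Complex.normSq (t - x) = - lineSide s t x := by
  have h0 : Complex.normSq (t - x) ≠ 0 := by
    rw [Ne, Complex.normSq_eq_zero]; exact sub_ne_zero.2 h
  rw [Complex.div_im]
  field_simp
  simp [lineSide]
  ring

theorem div_im_neg_of_lineSide_pos {s t x : ℂ} (h : t ≠ x) (hx : 0 < lineSide s t x) :
    ((s - x) / (t - x)).im < 0 := by
  have h0 : 0 < Complex.normSq (t - x) := Complex.normSq_pos.2 (sub_ne_zero.2 h)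
  have := div_im_mul_normSq s t x h
  by_contra! hc
  nlinarith [mul_nonneg hc h0.le]

theorem div_im_pos_of_lineSide_neg {s t x : ℂ} (h : t ≠ x) (hx : lineSide s t x < 0) :
    0 < ((s - x) / (t - x)).im := by
  have h0 : 0 < Complex.normSq (t - x) := Complex.normSq_pos.2 (sub_ne_zero.2 h)
  have := div_im_mul_normSq s t x h
  by_contra! hc
  nlinarith [mul_nonneg (neg_nonneg.2 hc) h0.le]

/-- Generic segments that meet are not collinear. -/
theorem lineSide_ne_zero_of_generic {s t a b z : ℂ} (ha : a ∉ segment ℝ s t)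
    (hb : b ∉ segment ℝ s t)
    (hs : s ∉ segment ℝ a b) (ht : t ∉ segment ℝ a b) (hz : z ∈ segment ℝ a b)
    (hz' : z ∈ segment ℝ s t) : lineSide s t a ≠ 0 := by
  intro h0
  have hst : s ≠ t := by
    rintro rfl
    rw [segment_same, Set.mem_singleton_iff] at hz'
    exact hs (hz' ▸ hz)
  have hz0 := lineSide_eq_zero_of_mem_segment hz'
  have hd : t - s ≠ 0 := sub_ne_zero.2 hst.symm
  have hn : 0 < Complex.normSq (t - s) := Complex.normSq_pos.2 hd
  -- a point of the line is given by its affine coordinate `c`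
  have coord : ∀ x : ℂ, lineSide s t x = 0 → ∃ c : ℝ, x = s + c * (t - s) := by
    intro x hx
    have hi : ((x - s) / (t - s)).im = 0 := by
      rw [Complex.div_im]
      field_simp
      unfold lineSide at hx
      linarith
    refine ⟨((x - s) / (t - s)).re, ?_⟩
    have : ((((x - s) / (t - s)).re : ℝ) : ℂ) = (x - s) / (t - s) :=
      Complex.ext (by simp) (by simpa using hi.symm)
    rw [this, div_mul_cancel₀ _ hd]
    ring
  have on : ∀ c : ℝ, 0 ≤ c → c ≤ 1 → s + c * (t - s) ∈ segment ℝ s t := fun c h1 h2 =>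
    ⟨1 - c, c, by linarith, h1, by ring, by simp; ring⟩
  have btw : ∀ c d e : ℝ, c ≤ e → e ≤ d → c < d →
      s + e * (t - s) ∈ segment ℝ (s + c * (t - s)) (s + d * (t - s)) := by
    intro c d e h1 h2 h3
    have h4 : d - c ≠ 0 := by linarith
    have h4' : (d - c : ℂ) ≠ 0 := by exact_mod_cast h4
    refine ⟨(d - e) / (d - c), (e - c) / (d - c), div_nonneg (by linarith) (by linarith),
      div_nonneg (by linarith) (by linarith), by field_simp; ring, ?_⟩
    simp only [Complex.real_smul]
    push_cast
    field_simp
    ring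
  obtain ⟨p, q, hp, hq, hpq, rfl⟩ := hz
  have hq0 : q ≠ 0 := by
    rintro rfl
    obtain rfl : p = 1 := by linarith
    simp only [one_smul, zero_smul, add_zero] at hz'
    exact ha hz'
  rw [lineSide_combo s t hpq, h0, mul_zero, zero_add] at hz0
  have hb0 : lineSide s t b = 0 := (mul_eq_zero.1 hz0).resolve_left hq0
  obtain ⟨α, hα⟩ := coord a h0
  obtain ⟨β, hβ⟩ := coord b hb0
  obtain ⟨p', q', hp', hq', hpq', hE⟩ := hz'
  have hζ : q' = p * α + q * β := by
    have : (q' : ℂ) * (t - s) = (p * α + q * β) * (t - s) := by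
      have e1 : (p : ℂ) = 1 - q := by rw [← Complex.ofReal_one, ← hpq]; push_cast; ring
      have e2 : (p' : ℂ) = 1 - q' := by rw [← Complex.ofReal_one, ← hpq']; push_cast; ring
      rw [hα, hβ] at hE
      simp only [Complex.real_smul, e1, e2] at hE
      rw [e1]
      linear_combination hE
    exact_mod_cast mul_right_cancel₀ hd this
  have hα' : α < 0 ∨ 1 < α := by
    by_contra! h
    exact ha (hα ▸ on α h.1 h.2)
  have hβ' : β < 0 ∨ 1 < β := by
    by_contra! h
    exact hb (hβ ▸ on β h.1 h.2)
  have hs0 : s = s + (0 : ℝ) * (t - s) := by simp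
  have hpe : p = 1 - q := by linarith
  subst hpe
  rcases hα' with h1 | h1 <;> rcases hβ' with h2 | h2
  · nlinarith [mul_nonneg hp (neg_nonneg.2 h1.le), mul_nonneg hq (neg_nonneg.2 h2.le),
      mul_pos (lt_of_le_of_ne hq hq0.symm) (neg_pos.2 h2)]
  · have h3 := btw α β 0 h1.le (by linarith) (by linarith)
    rw [← hs0, ← hα, ← hβ] at h3
    exact hs h3
  · have h3 := btw β α 0 h2.le (by linarith) (by linarith)
    rw [← hs0, ← hα, ← hβ, segment_symm] at h3
    exact hs h3
  · nlinarith [mul_nonneg hp (sub_nonneg.2 h1.le),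
      mul_pos (lt_of_le_of_ne hq hq0.symm) (sub_pos.2 h2)]

/-- For segments that cross, the branch `x ↦ arg (-(s - x) / (t - x))`, cut along the line through
`s` and `t` outside `[s, t]`, is continuous along `[a, b]`; comparing it with `x ↦ viewAngle x t s`
on the two sides of the line shows that the angle defect is `± 2π`. -/
theorem crossParity_eq_one_of_inter {s t a b z : ℂ} (hs : s ∉ segment ℝ a b)
    (ht : t ∉ segment ℝ a b) (hz : z ∈ segment ℝ a b) (hz' : z ∈ segment ℝ s t)
    (huniq : ∀ x ∈ segment ℝ a b, lineSide s t x = 0 → x = z)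
    (hab : lineSide s t a * lineSide s t b < 0) : crossParity s t a b = 1 := by
  have htx : ∀ x ∈ segment ℝ a b, t ≠ x := by rintro x hx rfl; exact ht hx
  have hsx : ∀ x ∈ segment ℝ a b, s ≠ x := by rintro x hx rfl; exact hs hx
  have hslit : ∀ x ∈ segment ℝ a b, -((s - x) / (t - x)) ∈ Complex.slitPlane := by
    intro x hx
    rw [Complex.mem_slitPlane_iff]
    by_cases h0 : lineSide s t x = 0
    · left
      rw [huniq x hx h0]
      obtain ⟨p, q, hp, hq, hpq, rfl⟩ := hz'
      have hp0 : p ≠ 0 := by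
        rintro rfl
        obtain rfl : q = 1 := by linarith
        exact htx _ hz (by simp)
      have hq0 : q ≠ 0 := by
        rintro rfl
        obtain rfl : p = 1 := by linarith
        exact hsx _ hz (by simp)
      have e1 : (p : ℂ) = 1 - q := by rw [← Complex.ofReal_one, ← hpq]; push_cast; ring
      have hp0' : (p : ℂ) ≠ 0 := by exact_mod_cast hp0
      have hst : t - s ≠ 0 := by
        intro h
        rw [sub_eq_zero] at h
        subst h
        apply htx _ hz
        rw [← add_smul, hpq, one_smul]
      have : -((s - (p • s + q • t)) / (t - (p • s + q • t))) = ((q / p : ℝ) : ℂ) := by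
        have e2 : s - (p • s + q • t) = -(q * (t - s)) := by
          simp only [Complex.real_smul, e1]; ring
        have e3 : t - (p • s + q • t) = p * (t - s) := by
          simp only [Complex.real_smul, e1]; ring
        rw [e2, e3]
        push_cast
        field_simp
      rw [this, Complex.ofReal_re]
      exact div_pos (lt_of_le_of_ne hq hq0.symm) (lt_of_le_of_ne hp hp0.symm)
    · right
      rw [Complex.neg_im, Ne, neg_eq_zero]
      rcases lt_or_gt_of_ne h0 with h | h
      · exact (div_im_pos_of_lineSide_neg (htx x hx) h).ne'
      · exact (div_im_neg_of_lineSide_pos (htx x hx) h).ne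
  have hμ := viewAngle_sub_viewAngle_eq hs ht
    (μ := fun x => Complex.arg (-((s - x) / (t - x)))) (c := Real.pi)
    (fun x hx => ((Complex.continuousAt_arg (hslit x hx)).comp
      (f := fun x => -((s - x) / (t - x)))
      (by fun_prop (disch := exact sub_ne_zero.2 (htx x hx)))).continuousWithinAt)
    (fun x hx => Complex.arg_neg_coe_angle
      (div_ne_zero (sub_ne_zero.2 (hsx x hx)) (sub_ne_zero.2 (htx x hx))))
  have ha := htx a (left_mem_segment ℝ a b)
  have hb := htx b (right_mem_segment ℝ a b)
  rcases mul_neg_iff.1 hab with ⟨h1, h2⟩ | ⟨h1, h2⟩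
  · simp only [Complex.arg_neg_eq_arg_add_pi_of_im_neg (div_im_neg_of_lineSide_pos ha h1),
      Complex.arg_neg_eq_arg_sub_pi_of_im_pos (div_im_pos_of_lineSide_neg hb h2)] at hμ
    rw [crossParity_of_eq (k := -1)]
    · decide
    · unfold angleDefect
      rw [hμ]
      simp only [viewAngle]
      push_cast
      ring
  · simp only [Complex.arg_neg_eq_arg_sub_pi_of_im_pos (div_im_pos_of_lineSide_neg ha h1),
      Complex.arg_neg_eq_arg_add_pi_of_im_neg (div_im_neg_of_lineSide_pos hb h2)] at hμ
    rw [crossParity_of_eq (k := 1)]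
    · simp
    · unfold angleDefect
      rw [hμ]
      simp only [viewAngle]
      push_cast
      ring

/-- In general position two segments meet at most once, and `crossParity` counts the meeting. -/
theorem crossParity_eq_ncard {s t a b : ℂ} (ha : a ∉ segment ℝ s t) (hb : b ∉ segment ℝ s t)
    (hs : s ∉ segment ℝ a b) (ht : t ∉ segment ℝ a b) :
    crossParity s t a b = ((segment ℝ a b ∩ segment ℝ s t).ncard : ZMod 2) := by
  rcases (segment ℝ a b ∩ segment ℝ s t).eq_empty_or_nonempty with he | ⟨z, hz, hz'⟩
  · rw [he, crossParity_eq_zero_of_disjoint (Set.disjoint_iff_inter_eq_empty.2 he)]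
    simp
  · have hA := lineSide_ne_zero_of_generic ha hb hs ht hz hz'
    have hz0 := lineSide_eq_zero_of_mem_segment hz'
    obtain ⟨p, q, hp, hq, hpq, hE⟩ := id hz
    have hq0 : q ≠ 0 := by
      rintro rfl
      obtain rfl : p = 1 := by linarith
      simp only [one_smul, zero_smul, add_zero] at hE
      exact ha (hE ▸ hz')
    have hp0 : p ≠ 0 := by
      rintro rfl
      obtain rfl : q = 1 := by linarith
      simp only [one_smul, zero_smul, zero_add] at hE
      exact hb (hE ▸ hz')
    have hqp : 0 < q := lt_of_le_of_ne hq hq0.symm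
    have hpp : 0 < p := lt_of_le_of_ne hp hp0.symm
    rw [← hE, lineSide_combo s t hpq] at hz0
    have hab : lineSide s t a * lineSide s t b < 0 := by
      have h1 : q * (lineSide s t a * lineSide s t b) = -(p * lineSide s t a ^ 2) := by
        linear_combination lineSide s t a * hz0
      have h2 : 0 < p * lineSide s t a ^ 2 := by positivity
      by_contra! hc
      nlinarith [mul_nonneg hqp.le hc]
    have hne : lineSide s t a - lineSide s t b ≠ 0 := by
      intro h
      rw [sub_eq_zero] at h
      rw [h] at hab
      nlinarith [mul_self_nonneg (lineSide s t b)]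
    have huniq : ∀ x ∈ segment ℝ a b, lineSide s t x = 0 → x = z := by
      rintro x ⟨p', q', -, -, hpq', rfl⟩ hx
      rw [lineSide_combo s t hpq'] at hx
      have hpp' : p' = p := by
        apply mul_right_cancel₀ hne
        linear_combination hx - hz0 - lineSide s t b * (hpq' - hpq)
      rw [← hE, hpp', show q' = q by linarith]
    have hset : segment ℝ a b ∩ segment ℝ s t = {z} := by
      apply Set.eq_singleton_iff_unique_mem.2
      exact ⟨⟨hz, hz'⟩, fun x hx => huniq x hx.1 (lineSide_eq_zero_of_mem_segment hx.2)⟩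
    rw [hset, crossParity_eq_one_of_inter hs ht hz hz' huniq hab]
    simp

/-- Around a point `p` outside a compact convex set there is a single-valued polar angle on the
set, since the set lies in an open half-plane bounded by a line through `p`. -/
theorem exists_viewAngle_eq_sub {C : Set ℂ} (hC : Convex ℝ C) (hc : IsCompact C) {p : ℂ}
    (hp : p ∉ C) : ∃ α : ℂ → ℝ, ∀ a ∈ C, ∀ b ∈ C, viewAngle p a b = α b - α a := by
  obtain ⟨f, u, hfp, hfC⟩ := geometric_hahn_banach_point_closed hC hc.isClosed hp
  set c : ℂ := f 1 - f Complex.I * Complex.I with hcdef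
  have hf : ∀ z : ℂ, (c * z).re = f z := by
    intro z
    have : f z = f (z.re • (1 : ℂ) + z.im • Complex.I) := by
      congr 1; simp [Complex.real_smul]
    rw [this, map_add, map_smul, map_smul]
    simp [hcdef]
    ring
  have hpos : ∀ x ∈ C, 0 < (c * (x - p)).re := by
    intro x hx
    rw [hf, map_sub]
    linarith [hfC x hx]
  refine ⟨fun x => Complex.arg (c * (x - p)), fun a ha b hb => ?_⟩
  have hc0 : c ≠ 0 := by rintro h0; have := hpos a ha; simp [h0] at this
  have hap : c * (a - p) ≠ 0 := by intro h; have := hpos a ha; simp [h] at this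
  have hbp : c * (b - p) ≠ 0 := by intro h; have := hpos b hb; simp [h] at this
  have h1 : viewAngle p a b = Complex.arg (c * (b - p) / (c * (a - p))) := by
    rw [viewAngle, mul_div_mul_left _ _ hc0]
  have h2 := Complex.arg_div_coe_angle hbp hap
  rw [← Real.Angle.coe_sub, Real.Angle.angle_eq_iff_two_pi_dvd_sub] at h2
  obtain ⟨k, hk⟩ := h2
  have ha' := abs_lt.1 (Complex.abs_arg_lt_pi_div_two_iff.2 (Or.inl (hpos a ha)))
  have hb' := abs_lt.1 (Complex.abs_arg_lt_pi_div_two_iff.2 (Or.inl (hpos b hb)))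
  have hl := Complex.neg_pi_lt_arg (c * (b - p) / (c * (a - p)))
  have hu := Complex.arg_le_pi (c * (b - p) / (c * (a - p)))
  have hpi := Real.pi_pos
  have hk1 : k < 1 := by
    have : (k : ℝ) < 1 := by by_contra! h; nlinarith
    exact_mod_cast this
  have hk2 : -1 < k := by
    have : (-1 : ℝ) < k := by by_contra! h; nlinarith
    exact_mod_cast this
  obtain rfl : k = 0 := by omega
  rw [h1]
  simp at hk
  linarith

/-- The crossing parity is a coboundary on each compact convex set that avoids `s` and `t`. -/
theorem exists_crossParity_eq_add {s t : ℂ} {C : Set ℂ} (hC : Convex ℝ C) (hc : IsCompact C)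
    (hs : s ∉ C) (ht : t ∉ C) :
    ∃ f : ℂ → ZMod 2, ∀ a ∈ C, ∀ b ∈ C, crossParity s t a b = f a + f b := by
  rcases C.eq_empty_or_nonempty with rfl | ⟨o, ho⟩
  · exact ⟨0, by simp⟩
  obtain ⟨α, hα⟩ := exists_viewAngle_eq_sub hC hc hs
  obtain ⟨β, hβ⟩ := exists_viewAngle_eq_sub hC hc ht
  have hne : ∀ {p : ℂ}, p ∉ C → ∀ x ∈ C, x ≠ p := by rintro p hp x hx rfl; exact hp hx
  have hint : ∀ a ∈ C, ∀ b ∈ C, ∃ k : ℤ, angleDefect s t a b = 2 * Real.pi * k :=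
    fun a ha b hb => exists_int_of_coe_angle_eq_zero
      (angleDefect_coe (hne hs a ha) (hne ht a ha) (hne hs b hb) (hne ht b hb))
  -- the parity from a base point `o` is a primitive
  refine ⟨crossParity s t o, fun a ha b hb => ?_⟩
  obtain ⟨k, hk⟩ := hint o ho a ha
  obtain ⟨l, hl⟩ := hint o ho b hb
  have hkl : angleDefect s t a b = 2 * Real.pi * ((l - k : ℤ) : ℝ) := by
    push_cast
    rw [mul_sub, ← hk, ← hl]
    simp only [angleDefect, hα a ha b hb, hα o ho a ha, hα o ho b hb, hβ a ha b hb,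
      hβ o ho a ha, hβ o ho b hb]
    ring
  rw [crossParity_of_eq hk, crossParity_of_eq hl, crossParity_of_eq hkl]
  push_cast
  rw [CharTwo.sub_eq_add, add_comm]

/-! ### Square grids -/

/-- Discrete Stokes formula on the square grid: if a finitely supported 1-cochain modulo `2`, with
values `h` on horizontal and `v` on vertical edges, vanishes on the edges across which `a` jumps,
then the sum of its coboundary over the squares, weighted by `a`, is zero. -/
theorem finsum_mul_coboundary_eq_zero {a h v : ℤ × ℤ → ZMod 2} (hh : h.support.Finite)
    (hv : v.support.Finite) (hah : ∀ p, a (p - (0, 1)) ≠ a p → h p = 0)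
    (hav : ∀ p, a (p - (1, 0)) ≠ a p → v p = 0) :
    ∑ᶠ p, a p * (h p + v (p + (1, 0)) + h (p + (0, 1)) + v p) = 0 := by
  have shift : ∀ (g : ℤ × ℤ → ZMod 2) (e : ℤ × ℤ), g.support.Finite →
      (∀ p, a (p - e) ≠ a p → g p = 0) →
      (Function.support fun p => a p * g p).Finite ∧
      (Function.support fun p => a p * g (p + e)).Finite ∧
      ∑ᶠ p, a p * g (p + e) = ∑ᶠ p, a p * g p := by
    intro g e hg hag
    refine ⟨hg.subset (Function.support_mul_subset_right _ _), ?_, ?_⟩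
    · refine (hg.preimage (f := fun p => p + e) (add_left_injective e).injOn).subset ?_
      exact Function.support_mul_subset_right _ _
    · rw [← finsum_comp_equiv (Equiv.subRight e)]
      refine finsum_congr fun p => ?_
      simp only [Equiv.subRight_apply, sub_add_cancel]
      by_cases hp : a (p - e) = a p
      · rw [hp]
      · rw [hag p hp, mul_zero, mul_zero]
  obtain ⟨h1, h2, h3⟩ := shift h (0, 1) hh hah
  obtain ⟨v1, v2, v3⟩ := shift v (1, 0) hv hav
  have : ∀ p, a p * (h p + v (p + (1, 0)) + h (p + (0, 1)) + v p) =
      (a p * h p + a p * h (p + (0, 1))) + (a p * v p + a p * v (p + (1, 0))) := by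
    intro p; ring
  rw [finsum_congr this, finsum_add_distrib, finsum_add_distrib h1 h2, finsum_add_distrib v1 v2,
    h3, v3, CharTwo.add_self_eq_zero, CharTwo.add_self_eq_zero, add_zero]
  · exact (h1.union h2).subset (Function.support_add _ _)
  · exact (v1.union v2).subset (Function.support_add _ _)

/-- The vertices of the square grid of mesh `2δ` in which `s` is the centre of a square. -/
noncomputable def gridPoint (s : ℂ) (δ : ℝ) (p : ℤ × ℤ) : ℂ :=
  ⟨s.re + δ * (2 * p.1 - 1), s.im + δ * (2 * p.2 - 1)⟩

/-- The closed square of the grid with lower left corner `gridPoint s δ p`. -/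
def gridSquare (s : ℂ) (δ : ℝ) (p : ℤ × ℤ) : Set ℂ :=
  Set.Icc (s.re + δ * (2 * p.1 - 1)) (s.re + δ * (2 * p.1 + 1)) ×ℂ
    Set.Icc (s.im + δ * (2 * p.2 - 1)) (s.im + δ * (2 * p.2 + 1))

theorem mem_gridSquare {s z : ℂ} {δ : ℝ} {p : ℤ × ℤ} : z ∈ gridSquare s δ p ↔
    (s.re + δ * (2 * p.1 - 1) ≤ z.re ∧ z.re ≤ s.re + δ * (2 * p.1 + 1)) ∧
      s.im + δ * (2 * p.2 - 1) ≤ z.im ∧ z.im ≤ s.im + δ * (2 * p.2 + 1) := Iff.rfl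

theorem convex_gridSquare (s : ℂ) (δ : ℝ) (p : ℤ × ℤ) : Convex ℝ (gridSquare s δ p) :=
  ((convex_Icc _ _).linear_preimage Complex.reLm).inter
    ((convex_Icc _ _).linear_preimage Complex.imLm)

theorem isCompact_gridSquare (s : ℂ) (δ : ℝ) (p : ℤ × ℤ) : IsCompact (gridSquare s δ p) :=
  isCompact_Icc.reProdIm isCompact_Icc

theorem dist_le_of_mem_gridSquare {s x y : ℂ} {δ : ℝ} {p : ℤ × ℤ} (hx : x ∈ gridSquare s δ p)
    (hy : y ∈ gridSquare s δ p) : dist x y ≤ 4 * δ := by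
  rw [mem_gridSquare] at hx hy
  rw [Complex.dist_eq]
  refine (Complex.norm_le_abs_re_add_abs_im _).trans ?_
  have h1 : |(x - y).re| ≤ 2 * δ := by
    rw [Complex.sub_re, abs_le]; constructor <;> linarith
  have h2 : |(x - y).im| ≤ 2 * δ := by
    rw [Complex.sub_im, abs_le]; constructor <;> linarith
  linarith

theorem gridPoint_mem_gridSquare {s : ℂ} {δ : ℝ} (hδ : 0 < δ) {p q : ℤ × ℤ}
    (h1 : p.1 = q.1 ∨ p.1 = q.1 + 1) (h2 : p.2 = q.2 ∨ p.2 = q.2 + 1) :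
    gridPoint s δ p ∈ gridSquare s δ q := by
  rw [mem_gridSquare]
  simp only [gridPoint]
  rcases h1 with h1 | h1 <;> rcases h2 with h2 | h2 <;> rw [h1, h2] <;> push_cast <;>
    refine ⟨⟨?_, ?_⟩, ?_, ?_⟩ <;> nlinarith

theorem center_mem_gridSquare_iff {s : ℂ} {δ : ℝ} (hδ : 0 < δ) {p : ℤ × ℤ} :
    s ∈ gridSquare s δ p ↔ p = 0 := by
  rw [mem_gridSquare]
  constructor
  · have key : ∀ (c : ℝ) (i : ℤ), c + δ * (2 * i - 1) ≤ c → c ≤ c + δ * (2 * i + 1) → i = 0 := by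
      intro c i h1 h2
      have h3 : (2 * i - 1 : ℝ) ≤ 0 := by
        by_contra! h; nlinarith [mul_pos hδ h]
      have h4 : (0 : ℝ) ≤ 2 * i + 1 := by
        by_contra! h; nlinarith [mul_pos hδ (neg_pos.2 h)]
      have h5 : 2 * i - 1 ≤ 0 := by exact_mod_cast h3
      have h6 : 0 ≤ 2 * i + 1 := by exact_mod_cast h4
      omega
    rintro ⟨⟨h1, h2⟩, h3, h4⟩
    exact Prod.ext (key _ _ h1 h2) (key _ _ h3 h4)
  · rintro rfl
    simp [hδ.le]

theorem finite_norm_gridPoint_le (s : ℂ) {δ : ℝ} (hδ : 0 < δ) (R : ℝ) :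
    {p : ℤ × ℤ | ‖gridPoint s δ p‖ ≤ R}.Finite := by
  obtain ⟨N, hN⟩ := exists_nat_gt ((R + ‖s‖) / δ + 1)
  have hN' : R + ‖s‖ < δ * (N - 1) := by
    have h1 : (R + ‖s‖) / δ < N - 1 := by linarith
    rw [div_lt_iff₀ hδ] at h1
    linarith
  refine (Set.finite_Icc ((-N, -N) : ℤ × ℤ) (N, N)).subset fun p hp => ?_
  have key : ∀ (c x : ℝ) (i : ℤ), |c| ≤ ‖s‖ → x = c + δ * (2 * i - 1) → |x| ≤ R →
      -(N : ℤ) ≤ i ∧ i ≤ N := by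
    intro c x i hc hx hR
    have hc' := abs_le.1 hc
    have hR' := abs_le.1 hR
    have hNp : (0 : ℝ) ≤ N := Nat.cast_nonneg N
    constructor
    · by_contra! h
      have : (i : ℝ) + 1 ≤ -N := by exact_mod_cast h
      nlinarith
    · by_contra! h
      have : (N : ℝ) + 1 ≤ i := by exact_mod_cast h
      nlinarith
  have h1 := key s.re _ p.1 (Complex.abs_re_le_norm s) rfl
    ((Complex.abs_re_le_norm (gridPoint s δ p)).trans hp)
  have h2 := key s.im _ p.2 (Complex.abs_im_le_norm s) rfl
    ((Complex.abs_im_le_norm (gridPoint s δ p)).trans hp)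
  exact ⟨⟨h1.1, h2.1⟩, h1.2, h2.2⟩

/-- The boundary of the square around `s` crosses the segment from `s` to `t` oddly: each of its
four edges is seen from `s` under a right angle. The edges are oriented in the coordinate
directions, so that two of the angles are `π / 2` and two are `-π / 2`. -/
theorem crossParity_gridSquare_center {s t : ℂ} {δ : ℝ} (hδ : 0 < δ)
    (ht : t ∉ gridSquare s δ 0) :
    crossParity s t (gridPoint s δ 0) (gridPoint s δ (1, 0)) +
      crossParity s t (gridPoint s δ (1, 0)) (gridPoint s δ (1, 1)) +
      crossParity s t (gridPoint s δ (0, 1)) (gridPoint s δ (1, 1)) +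
      crossParity s t (gridPoint s δ 0) (gridPoint s δ (0, 1)) = 1 := by
  set A := gridPoint s δ 0
  set B := gridPoint s δ (1, 0)
  set C := gridPoint s δ (1, 1)
  set D := gridPoint s δ (0, 1)
  have hA : A ∈ gridSquare s δ 0 := gridPoint_mem_gridSquare hδ (by simp) (by simp)
  have hB : B ∈ gridSquare s δ 0 := gridPoint_mem_gridSquare hδ (by simp) (by simp)
  have hC : C ∈ gridSquare s δ 0 := gridPoint_mem_gridSquare hδ (by simp) (by simp)
  have hD : D ∈ gridSquare s δ 0 := gridPoint_mem_gridSquare hδ (by simp) (by simp)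
  have eA : A - s = δ * (-1 - Complex.I) := by
    apply Complex.ext <;> simp [A, gridPoint]
  have eB : B - s = δ * (1 - Complex.I) := by
    apply Complex.ext <;> simp [B, gridPoint]; norm_num
  have eC : C - s = δ * (1 + Complex.I) := by
    apply Complex.ext <;> simp [C, gridPoint] <;> norm_num
  have eD : D - s = δ * (-1 + Complex.I) := by
    apply Complex.ext <;> simp [D, gridPoint]; norm_num
  have hδ' : (δ : ℂ) ≠ 0 := by exact_mod_cast hδ.ne'
  have nA : A - s ≠ 0 := by
    rw [eA]; refine mul_ne_zero hδ' fun h => ?_; simpa using congrArg Complex.re h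
  have nB : B - s ≠ 0 := by
    rw [eB]; refine mul_ne_zero hδ' fun h => ?_; simpa using congrArg Complex.re h
  have nC : C - s ≠ 0 := by
    rw [eC]; refine mul_ne_zero hδ' fun h => ?_; simpa using congrArg Complex.re h
  have nD : D - s ≠ 0 := by
    rw [eD]; refine mul_ne_zero hδ' fun h => ?_; simpa using congrArg Complex.re h
  have hI := Complex.I_sq
  have vAB : viewAngle s A B = Real.pi / 2 := by
    rw [viewAngle, (div_eq_iff nA).2 (show B - s = Complex.I * (A - s) by
      rw [eA, eB]; linear_combination (δ : ℂ) * hI), Complex.arg_I]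
  have vBC : viewAngle s B C = Real.pi / 2 := by
    rw [viewAngle, (div_eq_iff nB).2 (show C - s = Complex.I * (B - s) by
      rw [eC, eB]; linear_combination (δ : ℂ) * hI), Complex.arg_I]
  have vDC : viewAngle s D C = -(Real.pi / 2) := by
    rw [viewAngle, (div_eq_iff nD).2 (show C - s = -Complex.I * (D - s) by
      rw [eC, eD]; linear_combination (δ : ℂ) * hI), Complex.arg_neg_I]
  have vAD : viewAngle s A D = -(Real.pi / 2) := by
    rw [viewAngle, (div_eq_iff nA).2 (show D - s = -Complex.I * (A - s) by
      rw [eA, eD]; linear_combination (-δ : ℂ) * hI), Complex.arg_neg_I]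
  obtain ⟨β, hβ⟩ := exists_viewAngle_eq_sub (convex_gridSquare s δ 0)
    (isCompact_gridSquare s δ 0) ht
  have hne : ∀ x ∈ gridSquare s δ 0, x ≠ t := by rintro x hx rfl; exact ht hx
  have hint : ∀ {x y : ℂ}, x - s ≠ 0 → y - s ≠ 0 → x ∈ gridSquare s δ 0 → y ∈ gridSquare s δ 0 →
      ∃ k : ℤ, angleDefect s t x y = 2 * Real.pi * k := fun hx hy hx' hy' =>
    exists_int_of_coe_angle_eq_zero (angleDefect_coe (sub_ne_zero.1 hx) (hne _ hx')
      (sub_ne_zero.1 hy) (hne _ hy'))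
  obtain ⟨k, hk⟩ := hint nA nB hA hB
  obtain ⟨l, hl⟩ := hint nB nC hB hC
  obtain ⟨m, hm⟩ := hint nD nC hD hC
  obtain ⟨n, hn⟩ := hint nA nD hA hD
  have hsum : 2 * Real.pi * ((k + l - m - n : ℤ) : ℝ) = 2 * Real.pi * ((1 : ℤ) : ℝ) := by
    push_cast
    rw [mul_sub, mul_sub, mul_add, ← hk, ← hl, ← hm, ← hn]
    simp only [angleDefect, vAB, vBC, vDC, vAD, hβ A hA B hB, hβ B hB C hC, hβ D hD C hC,
      hβ A hA D hD]
    ring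
  have hsum' : k + l - m - n = 1 := by
    exact_mod_cast mul_left_cancel₀ (by positivity : (2 * Real.pi : ℝ) ≠ 0) hsum
  rw [crossParity_of_eq hk, crossParity_of_eq hl, crossParity_of_eq hm, crossParity_of_eq hn]
  have h2 := congrArg (Int.cast : ℤ → ZMod 2) hsum'
  push_cast at h2
  rw [CharTwo.sub_eq_add, CharTwo.sub_eq_add] at h2
  exact h2

/-- A convex set that contains both a point joined to `s` outside `A` and a point not so joined
meets `A`. -/
theorem exists_mem_of_not_joinedIn {E : Type*} [AddCommGroup E] [Module ℝ E]
    [TopologicalSpace E] [IsTopologicalAddGroup E] [ContinuousSMul ℝ E] {A C : Set E}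
    (hC : Convex ℝ C) {s x y : E} (hx : x ∈ C) (hy : y ∈ C) (h1 : JoinedIn Aᶜ s x)
    (h2 : ¬ JoinedIn Aᶜ s y) : ∃ z ∈ A, z ∈ C := by
  by_contra! h
  exact h2 (h1.trans (JoinedIn.of_segment_subset fun z hz hzA =>
    h z hzA (hC.segment_subset hx hy hz)))

/-- If the crossing parity with `[s, t]` is a coboundary near `A`, then `A` does not separate `s`
and `t`. Otherwise, let `a` be the indicator function of the squares of a fine grid that meet the
path component of `s`. Neighbouring squares between which `a` jumps are near `A`, so that the
crossing parity, corrected by the coboundary of `Φ`, vanishes on their common edge; by the discrete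
Stokes formula the boundaries of the squares with `a = 1` have even total crossing parity. But the
square around `s` is the only one of them that contributes, and it contributes `1`. -/
theorem joinedIn_compl_of_crossParity_eq_add {A : Set ℂ} {s t : ℂ} (hs : s ∉ A)
    {r : ℝ} (hr : 0 < r) (hrt : ∀ z ∈ A, r ≤ dist z t) {Φ : ℂ → ZMod 2} {R : ℝ}
    (hR : ∀ x, Φ x ≠ 0 → ‖x‖ ≤ R)
    (hΦ : ∀ z ∈ A, ∀ x ∈ Metric.ball z r, ∀ y ∈ Metric.ball z r,
      crossParity s t x y = Φ x + Φ y) :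
    JoinedIn Aᶜ s t := by
  classical
  by_contra hst
  -- two points of the same square are at distance at most `4δ < r`
  set δ : ℝ := r / 8 with hδdef
  have hδ : 0 < δ := by positivity
  have hδr : 4 * δ < r := by rw [hδdef]; linarith
  set P := gridPoint s δ with hP
  set Q := gridSquare s δ with hQ
  set a : ℤ × ℤ → ZMod 2 := fun p => if ∃ x ∈ Q p, JoinedIn Aᶜ s x then 1 else 0 with ha
  have ha1 : ∀ p, a p ≠ 0 → ∃ x ∈ Q p, JoinedIn Aᶜ s x := by
    intro p hp
    by_contra h
    exact hp (by simp only [ha, if_neg h])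
  have ha1' : ∀ p, (∃ x ∈ Q p, JoinedIn Aᶜ s x) → a p = 1 := fun p hp => by
    simp only [ha, if_pos hp]
  have ha0 : ∀ p, a p = 0 → ∀ x ∈ Q p, ¬ JoinedIn Aᶜ s x := by
    intro p hp x hx hj
    rw [ha1' p ⟨x, hx, hj⟩] at hp
    exact one_ne_zero hp
  have hat : ∀ p, a p ≠ 0 → t ∉ Q p := by
    intro p hp htp
    obtain ⟨x, hx, hj⟩ := ha1 p hp
    obtain ⟨z, hzA, hz⟩ := exists_mem_of_not_joinedIn (convex_gridSquare s δ p) hx htp hj hst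
    have := dist_le_of_mem_gridSquare hz htp
    linarith [hrt z hzA]
  -- the corrected cochain vanishes on the edges across which `a` jumps
  have jump : ∀ p q : ℤ × ℤ, a p ≠ a q → ∀ x ∈ Q p, x ∈ Q q → ∀ y ∈ Q p, y ∈ Q q →
      crossParity s t x y + (Φ x + Φ y) = 0 := by
    have aux : ∀ p q : ℤ × ℤ, a p ≠ 0 → a q = 0 → ∀ x ∈ Q p, x ∈ Q q → ∀ y ∈ Q p, y ∈ Q q →
        crossParity s t x y + (Φ x + Φ y) = 0 := by
      intro p q hp hq x hxp hxq y hyp hyq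
      obtain ⟨w, hw, hj⟩ := ha1 p hp
      obtain ⟨z, hzA, hz⟩ := exists_mem_of_not_joinedIn (convex_gridSquare s δ p) hw hxp hj
        (ha0 q hq x hxq)
      rw [hΦ z hzA x ((dist_le_of_mem_gridSquare hxp hz).trans_lt hδr) y
        ((dist_le_of_mem_gridSquare hyp hz).trans_lt hδr)]
      exact CharTwo.add_self_eq_zero _
    intro p q hpq x hxp hxq y hyp hyq
    by_cases hp : a p = 0
    · exact aux q p (fun h => hpq (hp.trans h.symm)) hp x hxq hxp y hyq hyp
    · refine aux p q hp ?_ x hxp hxq y hyp hyq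
      by_contra hq
      exact hpq ((ha1' p (ha1 p hp)).trans (ha1' q (ha1 q hq)).symm)
  have hseg : IsCompact (segment ℝ s t) := by
    rw [← convexHull_pair]; exact (Set.toFinite {s, t}).isCompact_convexHull ℝ
  obtain ⟨M, hM⟩ := hseg.isBounded.exists_norm_le
  -- far away, edges are disjoint from `[s, t]` and `Φ` vanishes
  have hfin : ∀ e : ℤ × ℤ, (∀ p, ‖P (p + e) - P p‖ ≤ 4 * δ) →
      (Function.support fun p => crossParity s t (P p) (P (p + e)) +
        (Φ (P p) + Φ (P (p + e)))).Finite := by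
    intro e he
    refine (finite_norm_gridPoint_le s hδ (max R M + 4 * δ)).subset fun p hp => ?_
    by_contra hbig
    rw [Set.mem_ofPred_eq, not_le] at hbig
    have h1 : max R M < ‖P (p + e)‖ := by
      have := norm_sub_norm_le (P p) (P (p + e))
      rw [norm_sub_rev] at this
      linarith [he p]
    have h2 : max R M < ‖P p‖ := by linarith
    apply hp
    have z1 : Φ (P p) = 0 := by
      by_contra h; linarith [hR _ h, le_max_left R M]
    have z2 : Φ (P (p + e)) = 0 := by
      by_contra h; linarith [hR _ h, le_max_left R M]
    have z3 : crossParity s t (P p) (P (p + e)) = 0 := by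
      apply crossParity_eq_zero_of_disjoint
      rw [Set.disjoint_left]
      intro x hx hx'
      have h3 : ‖x - P p‖ ≤ ‖P (p + e) - P p‖ := by
        rw [segment_eq_image'] at hx
        obtain ⟨θ, ⟨h0, h1⟩, rfl⟩ := hx
        simp only [add_sub_cancel_left, norm_smul, Real.norm_eq_abs, abs_of_nonneg h0]
        exact mul_le_of_le_one_left (norm_nonneg _) h1
      have h4 := hM x hx'
      have h5 := norm_sub_norm_le (P p) x
      rw [norm_sub_rev] at h5
      linarith [he p, le_max_right R M]
    simp only [z1, z2, z3, add_zero]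
  have hmem : ∀ p q : ℤ × ℤ, (p.1 = q.1 ∨ p.1 = q.1 + 1) → (p.2 = q.2 ∨ p.2 = q.2 + 1) →
      P p ∈ Q q := fun p q h1 h2 => gridPoint_mem_gridSquare hδ h1 h2
  have hstep : ∀ e : ℤ × ℤ, (e.1 = 0 ∨ e.1 = 1) → (e.2 = 0 ∨ e.2 = 1) →
      ∀ p, ‖P (p + e) - P p‖ ≤ 4 * δ := by
    intro e h1 h2 p
    rw [← dist_eq_norm]
    refine dist_le_of_mem_gridSquare (p := p) (hmem _ _ ?_ ?_) (hmem _ _ ?_ ?_) <;>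
      simp <;> assumption
  have hstokes := finsum_mul_coboundary_eq_zero (a := a)
    (hfin (1, 0) (hstep _ (by simp) (by simp))) (hfin (0, 1) (hstep _ (by simp) (by simp)))
    (fun p hp => jump _ _ hp _ (hmem _ _ (by simp) (by simp)) (hmem _ _ (by simp) (by simp))
      _ (hmem _ _ (by simp) (by simp)) (hmem _ _ (by simp) (by simp)))
    (fun p hp => jump _ _ hp _ (hmem _ _ (by simp) (by simp)) (hmem _ _ (by simp) (by simp))
      _ (hmem _ _ (by simp) (by simp)) (hmem _ _ (by simp) (by simp)))
  have hs0 : s ∈ Q 0 := (center_mem_gridSquare_iff hδ).2 rfl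
  have ha00 : a 0 = 1 := ha1' 0 ⟨s, hs0, JoinedIn.refl hs⟩
  have two : (2 : ZMod 2) = 0 := rfl
  rw [finsum_eq_single _ 0] at hstokes
  · have hc := crossParity_gridSquare_center hδ (hat 0 (by rw [ha00]; exact one_ne_zero))
    simp only [ha00, one_mul, zero_add, Prod.mk_add_mk, add_zero] at hstokes
    apply one_ne_zero (α := ZMod 2)
    rw [← hc, ← hstokes]
    linear_combination -(Φ (P 0) + Φ (P (1, 0)) + Φ (P (0, 1)) + Φ (P (1, 1))) * two
  · intro p hp
    by_cases hap : a p = 0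
    · rw [hap, zero_mul]
    · obtain ⟨f, hf⟩ := exists_crossParity_eq_add (convex_gridSquare s δ p)
        (isCompact_gridSquare s δ p) (fun h => hp ((center_mem_gridSquare_iff hδ).1 h)) (hat p hap)
      have c1 : P p ∈ Q p := hmem _ _ (by simp) (by simp)
      have c2 : P (p + (1, 0)) ∈ Q p := hmem _ _ (by simp) (by simp)
      have c3 : P (p + (0, 1)) ∈ Q p := hmem _ _ (by simp) (by simp)
      have c4 : P (p + (1, 0) + (0, 1)) ∈ Q p := hmem _ _ (by simp) (by simp)
      have c5 : p + (0, 1) + (1, 0) = p + (1, 0) + (0, 1) := add_right_comm _ _ _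
      rw [c5, hf _ c1 _ c2, hf _ c2 _ c4, hf _ c3 _ c4, hf _ c1 _ c3]
      linear_combination (a p * (f (P p) + f (P (p + (1, 0))) + f (P (p + (0, 1))) +
        f (P (p + (1, 0) + (0, 1))) + Φ (P p) + Φ (P (p + (1, 0))) + Φ (P (p + (0, 1))) +
        Φ (P (p + (1, 0) + (0, 1))))) * two

/-! ### Crossing parities in the Euclidean plane -/

/-- The plane, identified with the complex numbers. -/
noncomputable def planeToComplex : Plane ≃ₗᵢ[ℝ] ℂ :=
  Complex.orthonormalBasisOneI.repr.symm

/-- The crossing parity of segments in the plane. -/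
noncomputable def planeParity (s t a b : Plane) : ZMod 2 :=
  crossParity (planeToComplex s) (planeToComplex t) (planeToComplex a) (planeToComplex b)

theorem image_planeToComplex_segment (a b : Plane) :
    planeToComplex '' segment ℝ a b = segment ℝ (planeToComplex a) (planeToComplex b) :=
  image_segment ℝ planeToComplex.toLinearEquiv.toLinearMap.toAffineMap a b

theorem planeToComplex_mem_segment {x a b : Plane} :
    planeToComplex x ∈ segment ℝ (planeToComplex a) (planeToComplex b) ↔ x ∈ segment ℝ a b := by
  rw [← image_planeToComplex_segment, planeToComplex.injective.mem_set_image]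

theorem planeParity_eq_ncard {s t a b : Plane} (ha : a ∉ segment ℝ s t) (hb : b ∉ segment ℝ s t)
    (hs : s ∉ segment ℝ a b) (ht : t ∉ segment ℝ a b) :
    planeParity s t a b = ((segment ℝ a b ∩ segment ℝ s t).ncard : ZMod 2) := by
  rw [planeParity, crossParity_eq_ncard, ← image_planeToComplex_segment,
    ← image_planeToComplex_segment, ← Set.image_inter planeToComplex.injective,
    Set.ncard_image_of_injective _ planeToComplex.injective]
  all_goals rwa [planeToComplex_mem_segment]

theorem exists_planeParity_eq_add {s t : Plane} {C : Set Plane} (hC : Convex ℝ C)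
    (hc : IsCompact C) (hs : s ∉ C) (ht : t ∉ C) :
    ∃ f : Plane → ZMod 2, ∀ a ∈ C, ∀ b ∈ C, planeParity s t a b = f a + f b := by
  obtain ⟨f, hf⟩ := exists_crossParity_eq_add (s := planeToComplex s) (t := planeToComplex t)
    (C := planeToComplex '' C) (hC.linear_image planeToComplex.toLinearEquiv.toLinearMap)
    (hc.image planeToComplex.continuous) (by rwa [planeToComplex.injective.mem_set_image])
    (by rwa [planeToComplex.injective.mem_set_image])
  exact ⟨fun x => f (planeToComplex x), fun a ha b hb =>
    hf _ (Set.mem_image_of_mem _ ha) _ (Set.mem_image_of_mem _ hb)⟩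

theorem joinedIn_compl_of_planeParity_eq_add {A : Set Plane} {s t : Plane} (hs : s ∉ A)
    {r : ℝ} (hr : 0 < r) (hrt : ∀ z ∈ A, r ≤ dist z t) {Φ : Plane → ZMod 2} {R : ℝ}
    (hR : ∀ x, Φ x ≠ 0 → ‖x‖ ≤ R)
    (hΦ : ∀ z ∈ A, ∀ x ∈ Metric.ball z r, ∀ y ∈ Metric.ball z r,
      planeParity s t x y = Φ x + Φ y) :
    JoinedIn Aᶜ s t := by
  have h := joinedIn_compl_of_crossParity_eq_add (A := planeToComplex '' A)
    (s := planeToComplex s) (t := planeToComplex t) (r := r) (R := R)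
    (Φ := fun x => Φ (planeToComplex.symm x))
    (by rwa [planeToComplex.injective.mem_set_image]) hr
    (by rintro _ ⟨z, hz, rfl⟩; rw [planeToComplex.dist_map]; exact hrt z hz)
    (fun x hx => by rw [← planeToComplex.symm.norm_map]; exact hR _ hx)
    (by
      rintro _ ⟨z, hz, rfl⟩ x hx y hy
      obtain ⟨x, rfl⟩ := planeToComplex.surjective x
      obtain ⟨y, rfl⟩ := planeToComplex.surjective y
      rw [Metric.mem_ball, planeToComplex.dist_map] at hx hy
      simpa [planeParity] using hΦ z hz x hx y hy)
  have h2 := h.map planeToComplex.symm.continuous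
  rw [LinearIsometryEquiv.symm_apply_apply, LinearIsometryEquiv.symm_apply_apply] at h2
  refine h2.mono ?_
  rintro _ ⟨y, hy, rfl⟩ hyA
  exact hy ⟨_, hyA, by simp⟩

/-! ### Polygonal curves -/

theorem polyEdges_cons_cons (a b : Plane) (l : List Plane) :
    polyEdges (a :: b :: l) = (a, b) :: polyEdges (b :: l) := rfl

theorem mem_of_mem_polyEdges {π : List Plane} {e : Plane × Plane} (he : e ∈ polyEdges π) :
    e.1 ∈ π ∧ e.2 ∈ π :=
  ⟨(List.of_mem_zip he).1, List.mem_of_mem_tail (List.of_mem_zip he).2⟩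

theorem polyEdges_append_tail {A B : List Plane} {x : Plane} (hA : A.getLast? = some x)
    (hB : B.head? = some x) : polyEdges (A ++ B.tail) = polyEdges A ++ polyEdges B := by
  obtain ⟨l, rfl⟩ : ∃ l, B = x :: l := by
    cases B with
    | nil => simp at hB
    | cons b l => exact ⟨l, by simpa using hB⟩
  induction A with
  | nil => simp at hA
  | cons a A ih =>
    cases A with
    | nil =>
      obtain rfl : a = x := by simpa using hA
      rfl
    | cons b A =>
      rw [List.getLast?_cons_cons] at hA
      have := ih hA
      simp only [List.cons_append, polyEdges_cons_cons] at this ⊢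
      rw [this]

theorem mem_vertex_of_polyEdges_subset {S : Set Plane} {π : List Plane} {x : Plane}
    (h : π.head? = some x) (hx : x ∈ S) (hS : ∀ e ∈ polyEdges π, segment ℝ e.1 e.2 ⊆ S) :
    ∀ y ∈ π, y ∈ S := by
  induction π generalizing x with
  | nil => simp
  | cons a π ih =>
    obtain rfl : a = x := by simpa using h
    cases π with
    | nil => simpa using hx
    | cons b π =>
      rw [polyEdges_cons_cons] at hS
      intro y hy
      rcases List.mem_cons.1 hy with rfl | hy
      · exact hx
      · refine ih rfl ?_ (fun e he => hS e (List.mem_cons_of_mem _ he)) y hy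
        exact hS (a, b) List.mem_cons_self (right_mem_segment ℝ a b)

/-- A sum of increments along a polygonal curve telescopes. -/
theorem sum_polyEdges_eq_sub {M : Type*} [AddCommGroup M] {F : Plane × Plane → M} {G : Plane → M}
    {π : List Plane} {x y : Plane} (hx : π.head? = some x) (hy : π.getLast? = some y)
    (h : ∀ e ∈ polyEdges π, F e = G e.2 - G e.1) : ((polyEdges π).map F).sum = G y - G x := by
  induction π generalizing x with
  | nil => simp at hx
  | cons a π ih =>
    obtain rfl : a = x := by simpa using hx
    cases π with
    | nil =>
      obtain rfl : a = y := by simpa using hy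
      simp [polyEdges]
    | cons b π =>
      rw [polyEdges_cons_cons] at h ⊢
      rw [List.getLast?_cons_cons] at hy
      rw [List.map_cons, List.sum_cons, ih rfl hy (fun e he => h e (List.mem_cons_of_mem _ he)),
        h (a, b) List.mem_cons_self]
      abel

theorem CR_eq_sum_planeParity {s t : Plane} {π : List Plane}
    (h : ∀ e ∈ polyEdges π, ∃ π', IsGeneric s t π' ∧ e ∈ polyEdges π') :
    CR s t π = ((polyEdges π).map fun e => planeParity s t e.1 e.2).sum := by
  rw [CR, crossingNumber, Nat.cast_list_sum, List.map_map]
  congr 1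
  refine List.map_congr_left fun e he => ?_
  obtain ⟨π', hg, he'⟩ := h e he
  have hm := mem_of_mem_polyEdges he'
  exact (planeParity_eq_ncard (hg.1 _ hm.1) (hg.1 _ hm.2) (hg.2 e he').1 (hg.2 e he').2).symm

theorem CR_append_tail {s t : Plane} {A B : List Plane} {x : Plane} (hA : A.getLast? = some x)
    (hB : B.head? = some x) : CR s t (A ++ B.tail) = CR s t A + CR s t B := by
  simp only [CR, crossingNumber]
  rw [polyEdges_append_tail hA hB, List.map_append, List.sum_append, Nat.cast_add]

/-- A closed polygonal curve in `A` crosses `[s, t]` evenly when `A` does not separate `s` and `t`: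
the total angle that it sweeps around a point is a multiple of `2π` and depends continuously on
the point, so that it is the same for `s` and `t`. -/
theorem sum_planeParity_eq_zero_of_joinedIn {A : Set Plane} {s t : Plane} (hj : JoinedIn Aᶜ s t)
    {π : List Plane} {x : Plane} (hx : π.head? = some x) (hx' : π.getLast? = some x)
    (hA : ∀ e ∈ polyEdges π, segment ℝ e.1 e.2 ⊆ A) :
    ((polyEdges π).map fun e => planeParity s t e.1 e.2).sum = 0 := by
  set J := planeToComplex with hJ
  set W : Plane → ℝ := fun p => ((polyEdges π).map fun e => viewAngle (J p) (J e.1) (J e.2)).sum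
    with hW
  have hne : ∀ p ∉ A, ∀ e ∈ polyEdges π, J e.1 ≠ J p ∧ J e.2 ≠ J p := by
    intro p hp e he
    refine ⟨fun h => hp ?_, fun h => hp ?_⟩ <;> rw [← J.injective h] <;> apply hA e he
    · exact left_mem_segment ℝ _ _
    · exact right_mem_segment ℝ _ _
  have hcont : ContinuousOn W Aᶜ := by
    refine continuousOn_list_sum _ fun e he => ?_
    refine (continuousOn_viewAngle_left (a := J e.1) (b := J e.2) (S := J '' Aᶜ) ?_).comp
      J.continuous.continuousOn (Set.mapsTo_image _ _)
    rintro _ ⟨p, hp, rfl⟩ hmem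
    exact hp (hA e he (planeToComplex_mem_segment.1 hmem))
  have hint : ∀ p ∈ Aᶜ, (W p : Real.Angle) = 0 := by
    intro p hp
    have h1 : (W p : Real.Angle) =
        ((polyEdges π).map fun e => (viewAngle (J p) (J e.1) (J e.2) : Real.Angle)).sum := by
      have := map_list_sum Real.Angle.coeHom
        ((polyEdges π).map fun e => viewAngle (J p) (J e.1) (J e.2))
      rw [List.map_map] at this
      exact this
    rw [h1, sum_polyEdges_eq_sub (G := fun q => (Complex.arg (J q - J p) : Real.Angle)) hx hx'
      (fun e he => viewAngle_coe (hne p hp e he).1 (hne p hp e he).2), sub_self]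
  have hWst : W s = W t := by
    obtain ⟨γ, hγ⟩ := hj
    have := eq_of_continuousOn_of_coe_angle_eq_zero (S := Set.range γ)
      (isPreconnected_range γ.continuous) (f := W)
      (hcont.mono (Set.range_subset_iff.2 hγ)) (fun p hp => hint p (Set.range_subset_iff.2 hγ hp))
      (Set.mem_range_self 0) (Set.mem_range_self 1)
    simpa using this
  have hs := hj.source_mem
  have ht := hj.target_mem
  have hdef : ((polyEdges π).map fun e => angleDefect (J s) (J t) (J e.1) (J e.2)).sum = 0 := by
    have h1 := sum_polyEdges_eq_sub (π := π) hx hx'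
      (F := fun e => viewAngle (J e.2) (J t) (J s) - viewAngle (J e.1) (J t) (J s))
      (G := fun q => viewAngle (J q) (J t) (J s)) (fun e _ => rfl)
    have h2 : ∀ l : List (Plane × Plane),
        (l.map fun e => angleDefect (J s) (J t) (J e.1) (J e.2)).sum =
          (l.map fun e => viewAngle (J s) (J e.1) (J e.2)).sum -
          (l.map fun e => viewAngle (J t) (J e.1) (J e.2)).sum -
          (l.map fun e => viewAngle (J e.2) (J t) (J s) - viewAngle (J e.1) (J t) (J s)).sum := by
      intro l
      induction l with
      | nil => simp
      | cons e l ih =>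
        simp only [List.map_cons, List.sum_cons, ih]
        rw [angleDefect]
        ring
    rw [h2, h1, sub_self, sub_zero]
    exact sub_eq_zero.2 hWst
  have hk : ∀ l : List (Plane × Plane), (∀ e ∈ l, e ∈ polyEdges π) → ∃ k : ℤ,
      (l.map fun e => angleDefect (J s) (J t) (J e.1) (J e.2)).sum = 2 * Real.pi * k ∧
      (l.map fun e => planeParity s t e.1 e.2).sum = k := by
    intro l
    induction l with
    | nil => exact fun _ => ⟨0, by simp⟩
    | cons e l ih =>
      intro h
      obtain ⟨k, hk1, hk2⟩ := ih fun e he => h e (List.mem_cons_of_mem _ he)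
      have he := h e List.mem_cons_self
      obtain ⟨m, hm⟩ := exists_int_of_coe_angle_eq_zero (angleDefect_coe (hne s hs e he).1
        (hne t ht e he).1 (hne s hs e he).2 (hne t ht e he).2)
      refine ⟨m + k, ?_, ?_⟩
      · rw [List.map_cons, List.sum_cons, hk1, hm]; push_cast; ring
      · rw [List.map_cons, List.sum_cons, hk2, planeParity, crossParity_of_eq hm]; push_cast; rfl
  obtain ⟨k, hk1, hk2⟩ := hk _ fun _ => id
  rw [hdef] at hk1
  have : (k : ℝ) = 0 := by
    have := hk1.symm
    simpa [Real.pi_ne_zero] using this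
  obtain rfl : k = 0 := by exact_mod_cast this
  simpa using hk2

/-- In a set that avoids `s` and `t` and is star-shaped around `z`, the triangle `z a b` over a
segment `[a, b]` avoids `s` and `t` as well, so that its boundary is crossed evenly. -/
theorem planeParity_eq_sub_of_starConvex {s t z : Plane} {S : Set Plane}
    (hS : StarConvex ℝ z S) (hs : s ∉ S) (ht : t ∉ S) {a b : Plane}
    (hab : segment ℝ a b ⊆ S) :
    planeParity s t a b = planeParity s t z b - planeParity s t z a := by
  have hsub : convexHull ℝ {z, a, b} ⊆ S := by
    rw [convexHull_insert (Set.insert_nonempty _ _), convexHull_pair, convexJoin_singleton_left]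
    exact Set.iUnion₂_subset fun y hy => starConvex_iff_segment_subset.1 hS (hab hy)
  obtain ⟨f, hf⟩ := exists_planeParity_eq_add (s := s) (t := t)
    (convex_convexHull ℝ {z, a, b}) ((Set.toFinite _).isCompact_convexHull ℝ)
    (fun h => hs (hsub h)) (fun h => ht (hsub h))
  have hmem := subset_convexHull ℝ ({z, a, b} : Set Plane)
  rw [hf a (hmem (by simp)) b (hmem (by simp)), hf z (hmem (by simp)) b (hmem (by simp)),
    hf z (hmem (by simp)) a (hmem (by simp)), add_sub_add_left_eq_sub, CharTwo.sub_eq_add,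
    add_comm]

/-! ### Potentials on forests and sums along walks -/

/-- On a forest every symmetric 1-cochain modulo `2` is a coboundary: sum it along the paths from
a root of each component. -/
theorem exists_potential_of_isAcyclic {V : Type*} {T : SimpleGraph V} (hT : T.IsAcyclic)
    {e : V → V → ZMod 2} (he : ∀ u v, T.Adj u v → e v u = e u v) :
    ∃ φ : V → ZMod 2, ∀ u v, T.Adj u v → e u v = φ u + φ v := by
  obtain ⟨root, hroot⟩ : ∃ root : T.ConnectedComponent → V,
      ∀ c, T.connectedComponentMk (root c) = c := ⟨Quot.out, Quot.out_eq⟩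
  have hpath : ∀ v, ∃ P : T.Walk (root (T.connectedComponentMk v)) v, P.IsPath := fun v =>
    (SimpleGraph.ConnectedComponent.exact (hroot _)).exists_isPath
  -- the value at `v` is the sum along any path to `v` from the root of its component
  obtain ⟨φ, hφ⟩ : ∃ φ : V → ZMod 2, ∀ v (P : T.Walk (root (T.connectedComponentMk v)) v),
      P.IsPath → φ v = (P.darts.map fun d => e d.fst d.snd).sum := by
    choose P hP using hpath
    refine ⟨fun v => ((P v).darts.map fun d => e d.fst d.snd).sum, fun v Q hQ => ?_⟩
    have : P v = Q :=
      congrArg Subtype.val ((hT.subsingleton_path _ v).elim ⟨P v, hP v⟩ ⟨Q, hQ⟩)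
    simp only [this]
  have hφ' : ∀ (r v : V) (P : T.Walk r v), r = root (T.connectedComponentMk v) → P.IsPath →
      φ v = (P.darts.map fun d => e d.fst d.snd).sum := by
    rintro r v P rfl hP
    exact hφ v P hP
  have key : ∀ (r u v : V) (P : T.Walk r u) (Q : T.Walk r v) (h : T.Adj u v),
      r = root (T.connectedComponentMk u) → r = root (T.connectedComponentMk v) →
      P.IsPath → Q.IsPath → u ∈ Q.support → φ v = φ u + e u v := by
    intro r u v P Q h hu hv hP hQ hmem
    rw [hφ' r v Q hv hQ, hT.path_concat hP hQ h hmem, hφ' r u P hu hP,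
      SimpleGraph.Walk.darts_concat, List.concat_eq_append, List.map_append, List.sum_append]
    simp
  refine ⟨φ, fun u v h => ?_⟩
  obtain ⟨P, hP⟩ := hpath u
  obtain ⟨Q, hQ⟩ := hpath v
  have huv : root (T.connectedComponentMk u) = root (T.connectedComponentMk v) := by
    rw [SimpleGraph.ConnectedComponent.sound h.reachable]
  generalize hr : root (T.connectedComponentMk v) = r at Q huv
  generalize hr' : root (T.connectedComponentMk u) = r' at P huv
  subst huv
  by_cases hmem : u ∈ Q.support
  · rw [key _ u v P Q h hr'.symm hr.symm hP hQ hmem, ← add_assoc, CharTwo.add_self_eq_zero,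
      zero_add]
  · have hmem' : v ∈ P.support := hT.mem_support_of_ne_mem_support_of_adj_of_isPath hP hQ h hmem
    rw [key _ v u Q P h.symm hr.symm hr'.symm hQ hP hmem', he u v h, add_comm (φ v), add_assoc,
      CharTwo.add_self_eq_zero, add_zero]

theorem sum_darts_eq_of_potential {V : Type*} {G : SimpleGraph V} {e : V → V → ZMod 2}
    {φ : V → ZMod 2} {u v : V} (W : G.Walk u v)
    (h : ∀ d ∈ W.darts, e d.fst d.snd = φ d.fst + φ d.snd) :
    (W.darts.map fun d => e d.fst d.snd).sum = φ u + φ v := by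
  induction W with
  | nil => simp [CharTwo.add_self_eq_zero]
  | @cons u w v hadj W ih =>
    rw [SimpleGraph.Walk.darts_cons] at h ⊢
    rw [List.map_cons, List.sum_cons, ih fun d hd => h d (List.mem_cons_of_mem _ hd),
      h _ List.mem_cons_self]
    have : φ w + φ w = 0 := CharTwo.add_self_eq_zero _
    linear_combination this

/-! ### The drawing of the intersection graph -/

variable {V : Type*} {K : V → Set Plane}

theorem Drawing.walkCurve_head? (D : Drawing K) {u v : V} (W : (intersectionGraph K).Walk u v) :
    (D.walkCurve W).head? = some (D.point u) := by
  cases W with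
  | nil => rfl
  | cons h W =>
    rw [Drawing.walkCurve, List.head?_append, D.curve_head h]
    rfl

theorem Drawing.walkCurve_getLast? (D : Drawing K) {u v : V}
    (W : (intersectionGraph K).Walk u v) :
    (D.walkCurve W).getLast? = some (D.point v) := by
  induction W with
  | nil => rfl
  | @cons u w v h W ih =>
    rw [Drawing.walkCurve]
    have hh := D.walkCurve_head? W
    cases hW : D.walkCurve W with
    | nil => rw [hW] at hh; simp at hh
    | cons a l =>
      rw [hW] at hh ih
      obtain rfl : a = D.point w := by simpa using hh
      cases l with
      | nil =>
        rw [List.tail_cons, List.append_nil, D.curve_last h, ← ih]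
        rfl
      | cons b l =>
        rw [List.tail_cons, List.getLast?_append_of_ne_nil _ (List.cons_ne_nil b l), ← ih,
          List.getLast?_cons_cons]

theorem Drawing.CR_walkCurve (D : Drawing K) (s t : Plane) {u v : V}
    (W : (intersectionGraph K).Walk u v) :
    CR s t (D.walkCurve W) = (W.darts.map fun d => CR s t (D.curve d.fst d.snd)).sum := by
  induction W with
  | nil => simp [Drawing.walkCurve, CR, crossingNumber, polyEdges]
  | @cons u w v h W ih =>
    rw [Drawing.walkCurve, CR_append_tail (D.curve_last h) (D.walkCurve_head? W), ih,
      SimpleGraph.Walk.darts_cons, List.map_cons, List.sum_cons]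

theorem Drawing.polyEdges_walkCurve (D : Drawing K) {u v : V}
    (W : (intersectionGraph K).Walk u v) {x : Plane × Plane} (hx : x ∈ polyEdges (D.walkCurve W)) :
    ∃ a b, (intersectionGraph K).Adj a b ∧ x ∈ polyEdges (D.curve a b) := by
  induction W with
  | nil => simp [Drawing.walkCurve, polyEdges] at hx
  | @cons u w v h W ih =>
    rw [Drawing.walkCurve, polyEdges_append_tail (D.curve_last h) (D.walkCurve_head? W),
      List.mem_append] at hx
    exact hx.elim (fun hx => ⟨u, w, h, hx⟩) ih

theorem Drawing.mem_of_mem_curve (D : Drawing K) {u v : V} (h : (intersectionGraph K).Adj u v)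
    {x : Plane} (hx : x ∈ D.curve u v) : x ∈ K u ∪ K v :=
  mem_vertex_of_polyEdges_subset (D.curve_head h) (Or.inl (D.point_mem u)) (D.curve_subset h) x hx

theorem Drawing.Generic.CR_walkCurve_eq_sum {D : Drawing K} {s t : Plane} (hD : D.Generic s t)
    {u v : V} (W : (intersectionGraph K).Walk u v) :
    CR s t (D.walkCurve W) =
      ((polyEdges (D.walkCurve W)).map fun e => planeParity s t e.1 e.2).sum := by
  refine CR_eq_sum_planeParity fun e he => ?_
  obtain ⟨a, b, hab, hx⟩ := D.polyEdges_walkCurve W he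
  exact ⟨_, hD a b hab, hx⟩

/-- The crossing parity of the curve of an edge `uv` is that of any two segments joining its ends
to a common point of `K u` and `K v`, because `K u ∪ K v` is star-shaped around that point. -/
theorem Drawing.Generic.CR_curve (hconvex : ∀ v, Convex ℝ (K v)) {D : Drawing K} {s t : Plane}
    (hs : s ∉ ⋃ v, K v) (ht : t ∉ ⋃ v, K v)
    (hD : D.Generic s t) {u v : V} (h : (intersectionGraph K).Adj u v) {z : Plane}
    (hzu : z ∈ K u) (hzv : z ∈ K v) :
    CR s t (D.curve u v) = planeParity s t z (D.point u) + planeParity s t z (D.point v) := by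
  have hstar : StarConvex ℝ z (K u ∪ K v) :=
    ((hconvex u).starConvex hzu).union ((hconvex v).starConvex hzv)
  have hsub : K u ∪ K v ⊆ ⋃ v, K v :=
    Set.union_subset (Set.subset_iUnion K u) (Set.subset_iUnion K v)
  rw [CR_eq_sum_planeParity fun e he => ⟨_, hD u v h, he⟩,
    sum_polyEdges_eq_sub (G := fun x => planeParity s t z x)
    (D.curve_head h) (D.curve_last h) fun e he => planeParity_eq_sub_of_starConvex hstar
      (fun hh => hs (hsub hh)) (fun hh => ht (hsub hh)) (D.curve_subset h e he),
    CharTwo.sub_eq_add, add_comm]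

/-- If all fundamental cycles are drawn with even crossing parity, then the crossing parity of the
curves is the coboundary of a function on the nodes. -/
theorem exists_potential_of_not_hasOddFundamentalCycle {T : SimpleGraph V}
    (hT : IsMaxSpanningForest (intersectionGraph K) T) (D : Drawing K) {s t : Plane}
    (hsymm : ∀ u v, (intersectionGraph K).Adj u v →
      CR s t (D.curve v u) = CR s t (D.curve u v))
    (hodd : ¬ HasOddFundamentalCycle hT D s t) :
    ∃ φ : V → ZMod 2, ∀ u v, (intersectionGraph K).Adj u v →
      CR s t (D.curve u v) = φ u + φ v := by
  obtain ⟨φ, hφ⟩ := exists_potential_of_isAcyclic hT.acyclic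
    (e := fun u v => CR s t (D.curve u v)) fun u v h => hsymm u v (hT.le h)
  refine ⟨φ, fun u v h => ?_⟩
  by_cases hTuv : T.Adj u v
  · exact hφ u v hTuv
  have h1 : CR s t (D.walkCurve (fundamentalCycle hT h)) ≠ 1 := fun h1 => hodd ⟨u, v, h, hTuv, h1⟩
  have h0 : CR s t (D.walkCurve (fundamentalCycle hT h)) = 0 := by
    generalize CR s t (D.walkCurve (fundamentalCycle hT h)) = c at h1
    revert c; decide
  rw [D.CR_walkCurve, fundamentalCycle, SimpleGraph.Walk.darts_cons, List.map_cons, List.sum_cons,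
    sum_darts_eq_of_potential (e := fun u v => CR s t (D.curve u v)) (φ := φ)] at h0
  · have := CharTwo.add_eq_zero.1 h0
    rw [this, add_comm]
  · intro d hd
    apply hφ
    have hd' : d.edge ∈ ((hT.exists_path h).choose.mapLe hT.le).edges := List.mem_map_of_mem hd
    rw [SimpleGraph.Walk.edges_mapLe_eq_edges] at hd'
    exact SimpleGraph.Walk.adj_of_mem_edges _ hd'

/-! ### Separation and odd fundamental cycles -/

theorem eventually_disjoint_cthickening {A B : Set Plane} (h : Disjoint A B) (hA : IsCompact A)
    (hB : IsCompact B) :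
    ∀ᶠ r : ℝ in 𝓝[>] 0, Disjoint (Metric.cthickening r A) (Metric.cthickening r B) := by
  obtain ⟨δ, hδ, hd⟩ := h.exists_cthickenings hA hB.isClosed
  filter_upwards [Ioc_mem_nhdsGT hδ] with r hr
  exact hd.mono (Metric.cthickening_mono hr.2 _) (Metric.cthickening_mono hr.2 _)

/-- If all fundamental cycles cross `[s, t]` evenly, then the crossing parity is a coboundary near
the union: the potential `φ` of the nodes extends to thickenings of the sets by adding the
crossing parity of the segment from the point of the node. -/
theorem joinedIn_compl_of_not_hasOddFundamentalCycle [Finite V]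
    (hcompact : ∀ v, IsCompact (K v)) (hconvex : ∀ v, Convex ℝ (K v)) {s t : Plane}
    (hs : s ∉ ⋃ v, K v) (ht : t ∉ ⋃ v, K v) {D : Drawing K} {T : SimpleGraph V}
    (hT : IsMaxSpanningForest (intersectionGraph K) T) (hD : D.Generic s t)
    (hodd : ¬ HasOddFundamentalCycle hT D s t) : JoinedIn (⋃ v, K v)ᶜ s t := by
  classical
  have hcurve := fun {u v} (h : (intersectionGraph K).Adj u v) {z} =>
    Drawing.Generic.CR_curve hconvex hs ht hD h (z := z)
  obtain ⟨φ, hφ⟩ := exists_potential_of_not_hasOddFundamentalCycle hT D (fun u v h => by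
    obtain ⟨z, hzu, hzv⟩ := h.2
    rw [hcurve h hzu hzv, hcurve h.symm hzv hzu, add_comm]) hodd
  have hsing : ∀ x : Plane, x ∉ ⋃ v, K v → ∀ᶠ r : ℝ in 𝓝[>] 0, ∀ v,
      Disjoint (Metric.cthickening r {x}) (Metric.cthickening r (K v)) := fun x hx =>
    eventually_all.2 fun v => eventually_disjoint_cthickening
      (Set.disjoint_singleton_left.2 fun h => hx (Set.mem_iUnion_of_mem v h))
      isCompact_singleton (hcompact v)
  have hpair : ∀ᶠ r : ℝ in 𝓝[>] 0, ∀ u v, Disjoint (K u) (K v) →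
      Disjoint (Metric.cthickening r (K u)) (Metric.cthickening r (K v)) :=
    eventually_all.2 fun u => eventually_all.2 fun v => by
      by_cases h : Disjoint (K u) (K v)
      · filter_upwards [eventually_disjoint_cthickening h (hcompact u) (hcompact v)] with r hr _
        exact hr
      · exact Eventually.of_forall fun r h' => absurd h' h
  obtain ⟨r, ⟨⟨hrs, hrt⟩, hrp⟩, hr⟩ :=
    (((hsing s hs).and (hsing t ht)).and hpair).and self_mem_nhdsWithin |>.exists
  set C : V → Set Plane := fun v => Metric.cthickening r (K v) with hC
  have hKC : ∀ v, K v ⊆ C v := fun v => Metric.self_subset_cthickening _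
  have hpot : ∀ v, ∃ f : Plane → ZMod 2, ∀ a ∈ C v, ∀ b ∈ C v,
      planeParity s t a b = f a + f b := fun v =>
    exists_planeParity_eq_add ((hconvex v).cthickening r) (hcompact v).cthickening
      (Set.disjoint_left.1 (hrs v) (Metric.self_subset_cthickening _ rfl))
      (Set.disjoint_left.1 (hrt v) (Metric.self_subset_cthickening _ rfl))
  choose f hf using hpot
  set p := D.point with hp
  have hpC : ∀ v, p v ∈ C v := fun v => hKC v (D.point_mem v)
  have two : (2 : ZMod 2) = 0 := rfl
  -- the extension of the potential does not depend on the set used to define it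
  have hwell : ∀ u v x, x ∈ C u → x ∈ C v →
      φ u + planeParity s t (p u) x = φ v + planeParity s t (p v) x := by
    intro u v x hxu hxv
    by_cases huv : u = v
    · rw [huv]
    have hne : (K u ∩ K v).Nonempty := by
      rw [← Set.not_disjoint_iff_nonempty_inter]
      exact fun hd => Set.disjoint_left.1 (hrp u v hd) hxu hxv
    obtain ⟨z, hzu, hzv⟩ := id hne
    have h1 := hcurve ⟨huv, hne⟩ hzu hzv
    rw [hφ u v ⟨huv, hne⟩, hf u z (hKC u hzu) _ (hpC u), hf v z (hKC v hzv) _ (hpC v)] at h1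
    have h2 := hf u z (hKC u hzu) x hxu
    rw [hf v z (hKC v hzv) x hxv] at h2
    rw [hf u _ (hpC u) x hxu, hf v _ (hpC v) x hxv]
    linear_combination h1 - h2 + (f u (p u) - φ v + f v z) * two
  set Φ : Plane → ZMod 2 := fun x =>
    if h : ∃ u, x ∈ C u then φ h.choose + planeParity s t (p h.choose) x else 0 with hΦdef
  have hΦ : ∀ u x, x ∈ C u → Φ x = φ u + planeParity s t (p u) x := by
    intro u x hx
    have h : ∃ u, x ∈ C u := ⟨u, hx⟩
    simp only [hΦdef, dif_pos h]
    exact hwell _ _ x h.choose_spec hx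
  obtain ⟨R, hR⟩ : ∃ R, ∀ x ∈ ⋃ v, C v, ‖x‖ ≤ R :=
    (Bornology.isBounded_iUnion.2 fun v => (hcompact v).cthickening.isBounded).exists_norm_le
  refine joinedIn_compl_of_planeParity_eq_add hs hr ?_ (Φ := Φ) (R := R) ?_ ?_
  · intro z hz
    obtain ⟨v, hv⟩ := Set.mem_iUnion.1 hz
    by_contra! hlt
    exact Set.disjoint_left.1 (hrt v)
      (Metric.mem_cthickening_of_dist_le z t r _ rfl hlt.le) (hKC v hv)
  · intro x hx
    apply hR
    by_contra hx'
    rw [Set.mem_iUnion] at hx'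
    exact hx (by simp only [hΦdef, dif_neg hx'])
  · intro z hz x hx y hy
    obtain ⟨v, hv⟩ := Set.mem_iUnion.1 hz
    have hxC : x ∈ C v := Metric.mem_cthickening_of_dist_le x z r _ hv (le_of_lt hx)
    have hyC : y ∈ C v := Metric.mem_cthickening_of_dist_le y z r _ hv (le_of_lt hy)
    rw [hΦ v x hxC, hΦ v y hyC, hf v x hxC y hyC, hf v _ (hpC v) x hxC, hf v _ (hpC v) y hyC]
    linear_combination -(φ v + f v (p v)) * two

theorem separates_iff_hasOddFundamentalCycle [Finite V]
    (hcompact : ∀ v, IsCompact (K v)) (hconvex : ∀ v, Convex ℝ (K v)) {s t : Plane}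
    (hs : s ∉ ⋃ v, K v) (ht : t ∉ ⋃ v, K v) {D : Drawing K} {T : SimpleGraph V}
    (hT : IsMaxSpanningForest (intersectionGraph K) T) (hD : D.Generic s t) :
    Separates (⋃ v, K v) s t ↔ HasOddFundamentalCycle hT D s t := by
  constructor
  · intro hsep
    by_contra hodd
    exact hsep (joinedIn_compl_of_not_hasOddFundamentalCycle hcompact hconvex hs ht hT hD hodd)
  · rintro ⟨u, v, h, -, h1⟩ hj
    rw [hD.CR_walkCurve_eq_sum, sum_planeParity_eq_zero_of_joinedIn hj (D.walkCurve_head? _)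
      (D.walkCurve_getLast? _)] at h1
    · exact zero_ne_one h1
    · intro e he
      obtain ⟨a, b, hab, hx⟩ := D.polyEdges_walkCurve _ he
      exact (D.curve_subset hab e hx).trans
        (Set.union_subset (Set.subset_iUnion K a) (Set.subset_iUnion K b))

/-! ### Perturbation of the segment -/

/-- A point other than `t` lies on none of the segments from `s + ε n` to `t` with `ε` small: if
its offset from `t` in the direction of `n` is positive, then so is the least `ε` that reaches it;
otherwise no `ε` does. -/
theorem eventually_notMem_segment_add_smul {s t n x : Plane} (hn : n ≠ 0)
    (horth : inner ℝ n (t - s) = 0) (hx : x ≠ t) :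
    ∀ᶠ ε : ℝ in 𝓝[>] 0, x ∉ segment ℝ (s + ε • n) t := by
  have hnn : 0 < ‖n‖ ^ 2 := by positivity
  have key : ∀ ε : ℝ, x ∈ segment ℝ (s + ε • n) t → ∃ c : ℝ, 0 < c ∧ c ≤ 1 ∧
      inner ℝ n (x - t) = c * ε * ‖n‖ ^ 2 := by
    rintro ε ⟨c, d, hc, hd, hcd, rfl⟩
    have hc0 : c ≠ 0 := by
      rintro rfl
      obtain rfl : d = 1 := by linarith
      exact hx (by simp)
    refine ⟨c, lt_of_le_of_ne hc hc0.symm, by linarith, ?_⟩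
    have : c • (s + ε • n) + d • t - t = (c * ε) • n - c • (t - s) := by
      obtain rfl : d = 1 - c := by linarith
      module
    rw [this, inner_sub_right, inner_smul_right, inner_smul_right, horth, mul_zero, sub_zero,
      real_inner_self_eq_norm_sq]
  by_cases hpos : 0 < inner ℝ n (x - t)
  · filter_upwards [Ioo_mem_nhdsGT (div_pos hpos hnn)] with ε hε hmem
    obtain ⟨c, hc0, hc1, h⟩ := key ε hmem
    have h2 := (lt_div_iff₀ hnn).1 hε.2
    have h3 : c * (ε * ‖n‖ ^ 2) ≤ 1 * (ε * ‖n‖ ^ 2) :=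
      mul_le_mul_of_nonneg_right hc1 (mul_nonneg hε.1.le hnn.le)
    rw [h] at h2
    linarith
  · filter_upwards [self_mem_nhdsWithin] with ε hε hmem
    obtain ⟨c, hc0, hc1, h⟩ := key ε hmem
    exact hpos (h ▸ mul_pos (mul_pos hc0 hε) hnn)

theorem Drawing.eventually_generic [Finite V] {s t : Plane} (ht : t ∉ ⋃ v, K v) (D : Drawing K)
    {n : Plane} (hn : n ≠ 0) (horth : inner ℝ n (t - s) = 0)
    (hs : ∀ᶠ ε : ℝ in 𝓝[>] 0, s + ε • n ∉ ⋃ v, K v) :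
    ∀ᶠ ε : ℝ in 𝓝[>] 0, D.Generic (s + ε • n) t := by
  refine eventually_all.2 fun u => eventually_all.2 fun v => ?_
  by_cases h : (intersectionGraph K).Adj u v
  swap
  · exact Eventually.of_forall fun _ h' => absurd h' h
  have hsub : K u ∪ K v ⊆ ⋃ v, K v :=
    Set.union_subset (Set.subset_iUnion K u) (Set.subset_iUnion K v)
  have hvert : ∀ᶠ ε : ℝ in 𝓝[>] 0, ∀ x ∈ D.curve u v, x ∉ segment ℝ (s + ε • n) t := by
    have := (eventually_all_finite (l := 𝓝[>] (0 : ℝ)) (List.finite_toSet (D.curve u v))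
      (p := fun x ε => x ∉ segment ℝ (s + ε • n) t)).2 fun x hx =>
        eventually_notMem_segment_add_smul hn horth fun hxt =>
          ht (hsub (hxt ▸ D.mem_of_mem_curve h hx))
    exact this
  filter_upwards [hvert, hs] with ε h1 h2 _
  exact ⟨h1, fun e he => ⟨fun hm => h2 (hsub (D.curve_subset h e he hm)),
    fun hm => ht (hsub (D.curve_subset h e he hm))⟩⟩

end ConvexSeparation

theorem mainTheorem3 {V : Type*} [Finite V] (K : V → Set ConvexSeparation.Plane)
    (hcompact : ∀ v, IsCompact (K v)) (hconvex : ∀ v, Convex ℝ (K v))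
    (s t : ConvexSeparation.Plane) (hs : s ∉ ⋃ v, K v) (ht : t ∉ ⋃ v, K v)
    (D : ConvexSeparation.Drawing K) (T : SimpleGraph V)
    (hT : ConvexSeparation.IsMaxSpanningForest (ConvexSeparation.intersectionGraph K) T) :
    (D.Generic s t →
      (ConvexSeparation.Separates (⋃ v, K v) s t ↔
        ConvexSeparation.HasOddFundamentalCycle hT D s t)) ∧
    (∀ n : ConvexSeparation.Plane, n ≠ 0 → inner ℝ n (t - s) = 0 →
      ∀ᶠ ε : ℝ in 𝓝[>] 0,
        D.Generic (s + ε • n) t ∧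
        (ConvexSeparation.Separates (⋃ v, K v) s t ↔
          ConvexSeparation.HasOddFundamentalCycle hT D (s + ε • n) t)) := by
  refine ⟨ConvexSeparation.separates_iff_hasOddFundamentalCycle hcompact hconvex hs ht hT, ?_⟩
  intro n hn horth
  have hopen : IsOpen (⋃ v, K v)ᶜ := (isCompact_iUnion hcompact).isClosed.isOpen_compl
  obtain ⟨ρ, hρ, hball⟩ := Metric.isOpen_iff.1 hopen s hs
  -- `s` can be moved within a ball that avoids the union
  have hnear : ∀ᶠ ε : ℝ in 𝓝[>] 0, s + ε • n ∈ Metric.ball s ρ := by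
    have hc : Tendsto (fun ε : ℝ => s + ε • n) (𝓝 0) (𝓝 (s + (0 : ℝ) • n)) :=
      (by fun_prop : Continuous fun ε : ℝ => s + ε • n).tendsto 0
    rw [zero_smul, add_zero] at hc
    exact (hc.mono_left nhdsWithin_le_nhds).eventually (Metric.ball_mem_nhds s hρ)
  filter_upwards [hnear, D.eventually_generic ht hn horth (hnear.mono fun ε h => hball h)]
    with ε hε hgen
  refine ⟨hgen, ?_⟩
  rw [← ConvexSeparation.separates_iff_hasOddFundamentalCycle hcompact hconvex (hball hε) ht hT
    hgen]
  have hj : JoinedIn (⋃ v, K v)ᶜ s (s + ε • n) := JoinedIn.of_segment_subset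
    (((convex_ball s ρ).segment_subset (Metric.mem_ball_self hρ) hε).trans hball)
  exact not_congr ⟨hj.symm.trans, hj.trans⟩
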